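/- **Setting.** Let $d\in\{1,2,3\}$ and let $\mathcal D\subseteq[0,1]^d$ be a convex polytopal domain (the nonempty interior of the convex hull of finitely many points; an open interval for $d=1$). Let $V=H^1_0(\mathcal D)$ with norm $\|v\|_V=\|\nabla v\|_{L^2(\mathcal D)}$ and let $f\in V'$. Let $p\in(1,\infty)$, $s>0$ with $sp>d$, $\kappa>0$, $\gamma\in(-\infty,d]$, $\beta=2^{\gamma-d}$, and $\alpha\ge\max(1,s)$. *Wavelets.* Let $\phi,\psi\in C^\alpha(\mathbb R)$ be a compactly supported orthonormal scaling function and associated orthonormal wavelet of a multiresolution analysis of $L^2(\mathbb R)$, with $\int\psi(x)x^m\,dx=0$ for all integers $0\le m<\alpha$. Put $g_0=\phi$, $g_1=\psi$. Let $\mathcal I$ be the set of $(j,k,l)$ with $j\in\mathbb N_0$, $k\in K_j:=\{0,\dots,2^j-1\}^d$, $l\in\{0,1\}^d$, and $l\ne(0,\dots,0)$ if $j\ge1$, and set $$\psi_{j,k}^l(x)=\sum_{n\in\mathbb Z^d}2^{dj/2}\prod_{m=1}^d g_{l_m}\big(2^j(x_m-n_m)-k_m\big).$$ *Random tree prior.*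 On a probability space $(\Omega,\mathcal A,P)$ let $X=(X_{j,k}^l)_{(j,k,l)\in\mathcal I}$ be i.i.d. real random variables with density proportional to $\exp(-|x|^p/\kappa)$, and let $T$ be a Galton–Watson tree with offspring distribution $\mathrm{Bin}(2^d,\beta)$, independent of $X$; its nodes of length $j$ are elements of $\{1,\dots,2^d\}^j$. Fix maps $\iota_j:\{1,\dots,2^d\}^j\to K_j$, $j\in\mathbb N_0$ (for instance enumerations of $K_j$), and let $\mathcal I_T=\{(j,k,l)\in\mathcal I:\ k=\iota_j(\mathfrak n)\text{ for some }\mathfrak n\in T\text{ of length }j\}$. With $\eta_j=2^{-j(s+\frac d2-\frac dp)}$ let $$b_T=\sum_{(j,k,l)\in\mathcal I_T}\eta_jX_{j,k}^l\psi_{j,k}^l,\qquad b_{T,N}=\sum_{(j,k,l)\in\mathcal I_T,\ j\le N}\eta_jX_{j,k}^l\psi_{j,k}^l .$$ Let $a=\exp(b_T|_{\mathcal D})$, $a_N=\exp(b_{T,N}|_{\mathcal D})$, and let $u$, $u_N$ be the pathwise weak solutions: $u(\omega),u_N(\omega)\in V$ and $$\int_{\mathcal D}a(\omega)\nabla u(\omega)\cdot\nabla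 v\,dx=\langle f,v\rangle=\int_{\mathcal D}a_N(\omega)\nabla u_N(\omega)\cdot\nabla v\,dx\qquad\text{for all }v\in V.$$ **Theorem.** Almost surely the series $b_T$ converges absolutely at every point, and $u(\omega)$ and (for each $N$) $u_N(\omega)$ exist and are unique. For all $q\ge1$ and all $t\in\big(0,\,s-\frac dp-\frac{\min(\gamma,0)}q\big)$ there is a constant $C>0$ such that for every $N\in\mathbb N_0$ the map $u-u_N$ belongs to $L^q(\Omega;V)$ and $$\|u-u_N\|_{L^q(\Omega;V)}\le C\,2^{-Nt}.$$ -/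

import Mathlib

open MeasureTheory ProbabilityTheory Filter Topology Set
open scoped NNReal ENNReal RealInnerProductSpace

noncomputable section

namespace BesovTree

/-! ## The physical domain and the energy space -/

/-- Euclidean space of dimension `d`. -/
abbrev E (d : ℕ) : Type := EuclideanSpace ℝ (Fin d)

/-- Convex polytopal domains (open intervals for `d = 1`) of dimension `d ∈ {1, 2, 3}` that are
contained in the unit cube. -/
class IsPolytopalDomain {d : ℕ} (D : Set (E d)) : Prop where
  one_le_dim : 1 ≤ d
  dim_le_three : d ≤ 3
  exists_vertices : ∃ S : Finset (E d), D = interior (convexHull ℝ (S : Set (E d)))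
  nonempty : D.Nonempty
  subset_cube : ∀ x ∈ D, ∀ i, x i ∈ Icc (0 : ℝ) 1

/-- Smooth real functions with compact support in `D`. -/
def IsTestFunction {d : ℕ} (D : Set (E d)) (f : E d → ℝ) : Prop :=
  ContDiff ℝ ((⊤ : ℕ∞) : WithTop ℕ∞) f ∧ HasCompactSupport f ∧ tsupport f ⊆ D

/-- The pairs (function, gradient) in `L²(D) × L²(D; ℝᵈ)`. -/
abbrev L2Pair {d : ℕ} (D : Set (E d)) : Type :=
  Lp ℝ 2 ((volume : Measure (E d)).restrict D) × Lp (E d) 2 ((volume : Measure (E d)).restrict D)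

/-- The pairs `(f, ∇f)` with `f` a test function on `D`. -/
def testPairs {d : ℕ} (D : Set (E d)) : Submodule ℝ (L2Pair D) where
  carrier := {v | ∃ f : E d → ℝ, IsTestFunction D f ∧
    v.1 =ᵐ[volume.restrict D] f ∧ v.2 =ᵐ[volume.restrict D] gradient f}
  zero_mem' := by
    refine ⟨fun _ => 0, ⟨contDiff_const, HasCompactSupport.zero, ?_⟩, ?_, ?_⟩
    · simp [tsupport, Function.support]
    · exact Lp.coeFn_zero _ _ _
    · have h : gradient (fun _ : E d => (0 : ℝ)) = 0 := by
        ext1 x; simp [gradient]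
      rw [h]; exact Lp.coeFn_zero _ _ _
  add_mem' := by
    rintro v w ⟨f, ⟨hf, hf', hf''⟩, hv, hv'⟩ ⟨g, ⟨hg, hg', hg''⟩, hw, hw'⟩
    refine ⟨f + g, ⟨hf.add hg, hf'.add hg', ?_⟩, ?_, ?_⟩
    · exact (tsupport_add f g).trans (union_subset hf'' hg'')
    · exact (Lp.coeFn_add _ _).trans (hv.add hw)
    · have h : gradient (f + g) = gradient f + gradient g := by
        ext1 x
        simp only [gradient, Pi.add_apply]
        rw [fderiv_add (hf.differentiable (by simp) x) (hg.differentiable (by simp) x), map_add]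
      rw [h]
      exact (Lp.coeFn_add _ _).trans (hv'.add hw')
  smul_mem' := by
    rintro c v ⟨f, ⟨hf, hf', hf''⟩, hv, hv'⟩
    refine ⟨c • f, ⟨hf.const_smul c, ?_, ?_⟩, ?_, ?_⟩
    · exact hf'.smul_left (f := fun _ => c)
    · exact (closure_mono (Function.support_const_smul_subset c f)).trans hf''
    · exact (Lp.coeFn_smul _ _).trans (hv.const_smul c)
    · have h : gradient (c • f) = c • gradient f := by
        ext1 x
        simp only [gradient, Pi.smul_apply]
        rw [fderiv_const_smul (hf.differentiable (by simp) x)]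
        simp
      rw [h]
      exact (Lp.coeFn_smul _ _).trans (hv'.const_smul c)

/-- `H¹₀(D)`: the closure of the test functions in the `H¹` topology. A Sobolev function is stored
together with its weak gradient. -/
def H10 {d : ℕ} (D : Set (E d)) : Submodule ℝ (L2Pair D) := (testPairs D).topologicalClosure

/-- Poincaré inequality, which makes `v ↦ ‖∇v‖` a norm on `H¹₀(D)`. -/
theorem poincare_test {d : ℕ} {D : Set (E d)} [hD : IsPolytopalDomain D] {f : E d → ℝ}
    (hf : IsTestFunction D f) :
    ∫ x in D, f x ^ 2 ≤ 4 * ∫ x in D, ‖gradient f x‖ ^ 2 := by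
  obtain ⟨hs, hc, ht⟩ := hf
  have hd : 0 < d := hD.one_le_dim
  let i : Fin d := ⟨0, hd⟩
  let e : E d := EuclideanSpace.single i (1 : ℝ)
  have he : ‖e‖ = 1 := by simp [e]
  have hdiff : Differentiable ℝ f := hs.differentiable (by simp)
  have hfc : Continuous f := hs.continuous
  have hgc : Continuous (gradient f) :=
    (InnerProductSpace.toDual ℝ (E d)).symm.continuous.comp (hs.continuous_fderiv (by simp))
  have hg0 : ∀ x, x ∉ tsupport f → gradient f x = 0 := fun x hx => by
    have : fderiv ℝ f x = 0 := by
      by_contra h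
      exact hx (support_fderiv_subset ℝ h)
    simp [gradient, this]
  have hf0 : ∀ x, x ∉ tsupport f → f x = 0 := fun x hx => image_eq_zero_of_notMem_tsupport hx
  have hI : ∀ F : E d → ℝ, Continuous F → (∀ x, x ∉ tsupport f → F x = 0) → Integrable F :=
    fun F hF h0 => hF.integrable_of_hasCompactSupport (HasCompactSupport.intro hc h0)
  rw [setIntegral_eq_integral_of_forall_compl_eq_zero
      (fun x hx => by rw [hf0 x fun h => hx (ht h)]; simp),
    setIntegral_eq_integral_of_forall_compl_eq_zero
      (fun x hx => by rw [hg0 x fun h => hx (ht h)]; simp)]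
  have hxc : Continuous fun x : E d => x i := by fun_prop
  have hder : ∀ x, fderiv ℝ (fun y => f y ^ 2) x e = 2 * f x * ⟪gradient f x, e⟫ := fun x => by
    have h1 : fderiv ℝ f x e = ⟪gradient f x, e⟫ := by
      rw [← toDual_gradient, InnerProductSpace.toDual_apply_apply]
    have h2 := ((hdiff x).hasFDerivAt.pow 2).fderiv
    rw [h2, ← h1]; simp
  have hder' : ∀ x, fderiv ℝ (fun y : E d => y i) x e = 1 := fun x => by
    have h2 := ((EuclideanSpace.proj i : E d →L[ℝ] ℝ).hasFDerivAt (x := x)).fderiv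
    have h3 : (fun y : E d => y i) = (EuclideanSpace.proj i : E d →L[ℝ] ℝ) := rfl
    rw [h3, h2]; simp [e]
  have hint := integral_mul_fderiv_eq_neg_fderiv_mul_of_integrable (μ := (volume : Measure (E d)))
    (f := fun y : E d => y i) (g := fun y => f y ^ 2) (v := e)
    (hI _ (by simp only [hder']; fun_prop) (fun x hx => by simp [hf0 x hx]))
    (hI _ (by simp only [hder]; fun_prop) (fun x hx => by simp [hder, hf0 x hx]))
    (hI _ (by fun_prop) (fun x hx => by simp [hf0 x hx]))
    (fun x _ => by fun_prop) (fun x _ => (hdiff x).pow 2)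
  simp only [hder, hder', one_mul] at hint
  have hA : Integrable fun x => f x ^ 2 := hI _ (by fun_prop) (fun x hx => by simp [hf0 x hx])
  have hB : Integrable fun x => ‖gradient f x‖ ^ 2 :=
    hI _ (by fun_prop) (fun x hx => by simp [hg0 x hx])
  have hle : -∫ x, x i * (2 * f x * ⟪gradient f x, e⟫) ≤
      ∫ x, (f x ^ 2 / 2 + 2 * ‖gradient f x‖ ^ 2) := by
    rw [← integral_neg]
    refine integral_mono (hI _ (by fun_prop) (fun x hx => by simp [hf0 x hx]))
      ((hA.div_const 2).add (hB.const_mul 2)) fun x => ?_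
    by_cases hx : x ∈ tsupport f
    · have h1 := hD.subset_cube x (ht hx) i
      have h2 : |⟪gradient f x, e⟫| ≤ ‖gradient f x‖ := by
        have := abs_real_inner_le_norm (gradient f x) e
        rwa [he, mul_one] at this
      have h3 : |x i * (2 * f x * ⟪gradient f x, e⟫)| ≤ 2 * (|f x| * ‖gradient f x‖) := by
        rw [abs_mul, abs_mul, abs_mul, abs_of_nonneg h1.1, abs_two]
        calc x i * (2 * |f x| * |⟪gradient f x, e⟫|)
            ≤ 1 * (2 * |f x| * ‖gradient f x‖) := by gcongr; exact h1.2
          _ = _ := by ring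
      have h4 := neg_le_of_abs_le h3
      have h5 : |f x| ^ 2 = f x ^ 2 := sq_abs _
      simp only
      nlinarith [sq_nonneg (|f x| - 2 * ‖gradient f x‖)]
    · simp [hf0 x hx]
  rw [integral_add (hA.div_const 2) (hB.const_mul 2), integral_div, integral_const_mul] at hle
  linarith

theorem poincare {d : ℕ} {D : Set (E d)} [hD : IsPolytopalDomain D] (v : H10 D) :
    ‖v.1.1‖ ≤ 2 * ‖v.1.2‖ := by
  have hcl : IsClosed {v : L2Pair D | ‖v.1‖ ≤ 2 * ‖v.2‖} :=
    isClosed_le (by fun_prop) (by fun_prop)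
  have hsub : (testPairs D : Set (L2Pair D)) ⊆ {v : L2Pair D | ‖v.1‖ ≤ 2 * ‖v.2‖} := by
    rintro w ⟨f, hf, h1, h2⟩
    have e1 : ‖w.1‖ ^ 2 = ∫ x in D, f x ^ 2 := by
      rw [← real_inner_self_eq_norm_sq, L2.inner_def]
      refine integral_congr_ae ?_
      filter_upwards [h1] with x hx
      rw [hx]; simp [sq]
    have e2 : ‖w.2‖ ^ 2 = ∫ x in D, ‖gradient f x‖ ^ 2 := by
      rw [← real_inner_self_eq_norm_sq, L2.inner_def]
      refine integral_congr_ae ?_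
      filter_upwards [h2] with x hx
      rw [hx, real_inner_self_eq_norm_sq]
    have := poincare_test hf
    rw [← e1, ← e2] at this
    exact (sq_le_sq₀ (norm_nonneg _) (by positivity)).1 (by rw [mul_pow]; linarith)
  exact closure_minimal hsub hcl v.2

/-- The space `V = H¹₀(D)`. -/
def V {d : ℕ} (D : Set (E d)) : Type := H10 D

instance {d : ℕ} (D : Set (E d)) : AddCommGroup (V D) := inferInstanceAs (AddCommGroup (H10 D))

instance {d : ℕ} (D : Set (E d)) : Module ℝ (V D) := inferInstanceAs (Module ℝ (H10 D))

/-- The weak gradient, as a linear map. -/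
def V.grad {d : ℕ} {D : Set (E d)} :
    V D →ₗ[ℝ] Lp (E d) 2 ((volume : Measure (E d)).restrict D) :=
  (LinearMap.snd ℝ _ _) ∘ₗ (H10 D).subtype

theorem V.grad_injective {d : ℕ} {D : Set (E d)} [IsPolytopalDomain D] :
    Function.Injective (V.grad : V D → _) := by
  refine (injective_iff_map_eq_zero _).2 fun v hv => ?_
  have h2 : v.1.2 = 0 := hv
  have h1 : v.1.1 = 0 := by
    have := poincare (D := D) v
    rw [h2, norm_zero, mul_zero] at this
    exact norm_le_zero_iff.1 this
  exact Subtype.ext (Prod.ext h1 h2)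

/-- The norm of `V` is `‖v‖ = ‖∇v‖_{L²(D)}`. -/
instance {d : ℕ} (D : Set (E d)) [IsPolytopalDomain D] : NormedAddCommGroup (V D) :=
  NormedAddCommGroup.induced (V D) _ V.grad V.grad_injective

instance {d : ℕ} (D : Set (E d)) [IsPolytopalDomain D] : NormedSpace ℝ (V D) :=
  NormedSpace.induced ℝ (V D) _ V.grad

/-- `u ∈ V` is a weak solution of `-∇·(a ∇u) = f` in `D`, `u = 0` on `∂D`, for `f ∈ V'`. -/
def IsWeakSolution {d : ℕ} (D : Set (E d)) [IsPolytopalDomain D] (a : E d → ℝ)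
    (f : V D →L[ℝ] ℝ) (u : V D) : Prop :=
  ∀ v : V D, IntegrableOn (fun x => a x * ⟪V.grad u x, V.grad v x⟫) D ∧
    ∫ x in D, a x * ⟪V.grad u x, V.grad v x⟫ = f v

/-! ## Wavelets -/

/-- The class `C^α(ℝ)` for real `α > 0`. It is only used for compactly supported functions. -/
def IsHolderRegular (α : ℝ) (g : ℝ → ℝ) : Prop :=
  ContDiff ℝ (⌊α⌋₊ : ℕ) g ∧
    ∀ r : ℝ≥0, (r : ℝ) = α - ⌊α⌋₊ → r ≠ 0 → ∃ C : ℝ≥0, HolderWith C r (iteratedDeriv ⌊α⌋₊ g)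

/-- The closed span in `L²(ℝ)` of the functions `x ↦ g (2^j x - k)`, `k ∈ ℤ`. -/
def dilateSpace (g : ℝ → ℝ) (j : ℤ) : Submodule ℝ (Lp ℝ 2 (volume : Measure ℝ)) :=
  (Submodule.span ℝ {v : Lp ℝ 2 (volume : Measure ℝ) |
    ∃ k : ℤ, v =ᵐ[volume] fun x => g ((2 : ℝ) ^ j * x - k)}).topologicalClosure

/-- `φ` is an orthonormal scaling function and `ψ` an associated orthonormal wavelet of a
multiresolution analysis of `L²(ℝ)`. -/
structure IsMRA (φ ψ : ℝ → ℝ) : Prop where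
  orthonormal_scaling : ∀ k : ℤ, ∫ x, φ x * φ (x - k) = if k = 0 then 1 else 0
  orthonormal_wavelet : ∀ k : ℤ, ∫ x, ψ x * ψ (x - k) = if k = 0 then 1 else 0
  orthogonal : ∀ k : ℤ, ∫ x, φ x * ψ (x - k) = 0
  nested : ∀ j : ℤ, dilateSpace φ j ≤ dilateSpace φ (j + 1)
  dense : (⨆ j : ℤ, dilateSpace φ j).topologicalClosure = ⊤
  separated : (⨅ j : ℤ, dilateSpace φ j) = ⊥
  complement : dilateSpace φ 1 = dilateSpace φ 0 ⊔ dilateSpace ψ 0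

/-- The assumptions on the univariate scaling function `φ` and wavelet `ψ`: a compactly supported
orthonormal pair in `C^α(ℝ)` with vanishing moments of all orders `m < α`. -/
structure IsWaveletPair (α : ℝ) (φ ψ : ℝ → ℝ) : Prop where
  compact_scaling : HasCompactSupport φ
  compact_wavelet : HasCompactSupport ψ
  regular_scaling : IsHolderRegular α φ
  regular_wavelet : IsHolderRegular α ψ
  mra : IsMRA φ ψ
  vanishing_moments : ∀ m : ℕ, (m : ℝ) < α → ∫ x, ψ x * x ^ m = 0

/-- The wavelet indices `(j, k, l)` with `j ∈ ℕ₀`, `k ∈ {0, …, 2^j - 1}^d` and `l ∈ {0, 1}^d`,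
where `l = (0, …, 0)` occurs for `j = 0` only. The values `false`, `true` stand for `0`, `1`. -/
abbrev WaveletIndex (d : ℕ) : Type :=
  Σ j : ℕ, (Fin d → Fin (2 ^ j)) × {l : Fin d → Bool // j = 0 ∨ l ≠ fun _ => false}

/-- The one-periodic wavelet
`∑_{n ∈ ℤᵈ} 2^{dj/2} ∏_m g_m (2^j (x_m - n_m) - k_m)`, with `g_m = φ` if `l_m = 0` and `g_m = ψ`
if `l_m = 1`. -/
def wavelet {d : ℕ} (φ ψ : ℝ → ℝ) (i : WaveletIndex d) (x : E d) : ℝ :=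
  ∑' n : Fin d → ℤ, (2 : ℝ) ^ ((d : ℝ) * i.1 / 2) *
    ∏ m : Fin d, (if i.2.2.1 m then ψ else φ) ((2 : ℝ) ^ i.1 * (x m - n m) - (i.2.1 m : ℕ))

/-! ## Galton-Watson trees -/

/-- Rooted plane trees all of whose nodes have finitely many children, as sets of finite sequences:
the children of the node `n` are `n ++ [i]`, `0 ≤ i < K`. -/
structure PlaneTree where
  carrier : Set (List ℕ)
  root_mem : [] ∈ carrier
  ancestor_mem : ∀ n m : List ℕ, n ++ m ∈ carrier → n ∈ carrier
  children : ∀ n ∈ carrier, ∃ K : ℕ, ∀ i : ℕ, n ++ [i] ∈ carrier ↔ i < K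

namespace PlaneTree

/-- The nodes of length at most `n`. -/
def truncation (t : PlaneTree) (n : ℕ) : Set (List ℕ) := {m ∈ t.carrier | m.length ≤ n}

/-- The number of children of the root. -/
def rootDegree (t : PlaneTree) : ℕ := {i : ℕ | [i] ∈ t.carrier}.ncard

/-- The sub-tree above the node `n` (the one-point tree if `n` is not a node of `t`). -/
def subtree (t : PlaneTree) (n : List ℕ) : PlaneTree where
  carrier := {m | m = [] ∨ n ++ m ∈ t.carrier}
  root_mem := Or.inl rfl
  ancestor_mem := by
    rintro m m' (h | h)
    · exact Or.inl (List.append_eq_nil_iff.1 h).1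
    · exact Or.inr (t.ancestor_mem (n ++ m) m' (by simpa using h))
  children := by
    intro m _
    by_cases h : n ++ m ∈ t.carrier
    · obtain ⟨K, hK⟩ := t.children _ h
      exact ⟨K, fun i => by simpa using hK i⟩
    · refine ⟨0, fun i => ?_⟩
      have : n ++ (m ++ [i]) ∉ t.carrier := fun h' =>
        h (t.ancestor_mem (n ++ m) [i] (by simpa using h'))
      simpa using this

/-- The σ-algebra generated by the balls `{t' | t' and t coincide up to generation n}`. -/
instance : MeasurableSpace PlaneTree :=
  MeasurableSpace.generateFrom
    {A | ∃ (t : PlaneTree) (n : ℕ), A = {t' | t'.truncation n = t.truncation n}}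

end PlaneTree

/-- `T` is a Galton-Watson tree whose offspring distribution has the weights `w`: it has the
branching property (given that the root has `n` children, the `n` sub-trees above them are
independent and distributed as `T`), and the number of children of the root has the weights `w`. -/
structure IsGaltonWatson {Ω : Type*} [MeasurableSpace Ω] (P : Measure Ω) (T : Ω → PlaneTree)
    (w : ℕ → ℝ) : Prop where
  measurable : Measurable T
  branching : ∀ n : ℕ, P {ω | (T ω).rootDegree = n} ≠ 0 →
    iIndepFun (fun (i : Fin n) ω => (T ω).subtree [(i : ℕ)]) P[|{ω | (T ω).rootDegree = n}] ∧
    ∀ i : Fin n, Measure.map (fun ω => (T ω).subtree [(i : ℕ)]) P[|{ω | (T ω).rootDegree = n}] =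
      Measure.map T P
  offspring : ∀ n : ℕ, P {ω | (T ω).rootDegree = n} = ENNReal.ofReal (w n)

/-- The weights of the binomial distribution `Bin(m, β)`. -/
def binomialWeight (m : ℕ) (β : ℝ) (n : ℕ) : ℝ := m.choose n * β ^ n * (1 - β) ^ (m - n)

/-! ## Besov random tree priors -/

/-- The density of the `p`-exponential distribution with scaling parameter `κ`. -/
def pExpDensity (p κ : ℝ) (x : ℝ) : ℝ :=
  (∫ y : ℝ, Real.exp (-(|y| ^ p / κ)))⁻¹ * Real.exp (-(|x| ^ p / κ))

/-- `X` is an i.i.d. family of `p`-exponential random variables. -/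
structure IsPExponentialFamily {Ω ι : Type*} [MeasurableSpace Ω] (P : Measure Ω) (p κ : ℝ)
    (X : ι → Ω → ℝ) : Prop where
  measurable : ∀ i, Measurable (X i)
  law : ∀ i, Measure.map (X i) P = volume.withDensity fun x => ENNReal.ofReal (pExpDensity p κ x)
  indep : iIndepFun X P

/-- The wavelet indices activated by the tree `t`: those `(j, k, l)` for which some node of `t` of
length `j` with labels in `{0, …, 2^d - 1}` is sent to `k` by the node-to-position map `pos j`. -/
def activeIndices {d : ℕ} (pos : ∀ j : ℕ, (Fin j → Fin (2 ^ d)) → (Fin d → Fin (2 ^ j)))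
    (t : PlaneTree) : Set (WaveletIndex d) :=
  {i | ∃ n : Fin i.1 → Fin (2 ^ d),
    List.ofFn (fun m => ((n m : Fin (2 ^ d)) : ℕ)) ∈ t.carrier ∧ pos i.1 n = i.2.1}

/-- The term of index `i = (j, k, l)` of a Besov random tree prior, at the point `x`:
`η_j X_i ψ_i(x)` with `η_j = 2^{-j(s + d/2 - d/p)}` if `i` is active, and `0` otherwise. -/
def priorTerm {d : ℕ} (φ ψ : ℝ → ℝ) (s p : ℝ)
    (pos : ∀ j : ℕ, (Fin j → Fin (2 ^ d)) → (Fin d → Fin (2 ^ j)))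
    (X : WaveletIndex d → ℝ) (t : PlaneTree) (x : E d) : WaveletIndex d → ℝ :=
  (activeIndices pos t).indicator fun i =>
    (2 : ℝ) ^ (-((i.1 : ℝ) * (s + d / 2 - d / p))) * X i * wavelet φ ψ i x

/-- The Besov random tree prior `b_T`, as a one-periodic function on `ℝᵈ`. -/
def prior {d : ℕ} (φ ψ : ℝ → ℝ) (s p : ℝ)
    (pos : ∀ j : ℕ, (Fin j → Fin (2 ^ d)) → (Fin d → Fin (2 ^ j)))
    (X : WaveletIndex d → ℝ) (t : PlaneTree) (x : E d) : ℝ :=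
  ∑' i, priorTerm φ ψ s p pos X t x i

/-- The prior `b_{T,N}` truncated after the scale `N`. -/
def truncatedPrior {d : ℕ} (φ ψ : ℝ → ℝ) (s p : ℝ)
    (pos : ∀ j : ℕ, (Fin j → Fin (2 ^ d)) → (Fin d → Fin (2 ^ j)))
    (X : WaveletIndex d → ℝ) (t : PlaneTree) (N : ℕ) (x : E d) : ℝ :=
  ∑' i : {i : WaveletIndex d // i.1 ≤ N}, priorTerm φ ψ s p pos X t x i

end BesovTree

end

open BesovTree

noncomputable section

namespace BesovTree

/-! ## The elliptic problem -/

/-! The error estimate is a pathwise bound followed by Hölder's inequality. Write δ = s - d/p.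

Pathwise, two exponents bounded by M whose sup-distance is ε give solutions at distance at most
e^{3M} ε ‖f‖ (`IsWeakSolution.norm_sub_le_exp`). It remains to control the sup norms of `b_T`,
`b_{T,N}` and of the tail `b_T - b_{T,N}`. At scale j the wavelets of one type satisfy ∑_k
|ψ_{j,k}^l(x)| ≤ C 2^{dj/2}, because only boundedly many of them see a given point. Since η_j
2^{dj/2} = 2^{-jδ}, a coefficient bound |c_i| ≤ 2^{j(δ-τ)} Q makes scale j contribute O(2^{-jτ} Q),
and the scales from N on contribute O(2^{-Nτ} Q) (`exists_abs_tsum_coeffTerm_le`).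

Two random variables supply such bounds. For the sup norm, τ = δ/2 and the tree is ignored: p > 1
gives all exponential moments of the X_i, hence |X_i| ≤ 2^{jδ/2} Z with E e^{lZ} finite for any
prescribed l (`exists_exponential_bound`). For the tail, τ = t and the tree matters: the expected
number of active indices at scale j is O(2^{γj}), so ∑ 2^{-j(δ-t)r} |X_i|^r over active indices has
finite expectation as soon as γ < (δ-t)r; its r-th root serves as Q (`exists_moment_bound`).

Thus ‖u - u_N‖ ≤ C 2^{-Nt} e^{3C₁Z} Q ‖f‖. The assumption on t is exactly what allows some r > q
with γ < (δ-t)r (`exists_gt_lt_mul`); the strict inequality r > q leaves room to put the exponential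
factor in L^{r'} with 1/q = 1/r + 1/r'. Measurability of u_N holds because it depends continuously
on finitely many coefficients, and u is an almost sure limit of the u_N. -/

theorem _root_.IsCoercive.exists_eq_apply {W : Type*} [NormedAddCommGroup W]
    [InnerProductSpace ℝ W] [CompleteSpace W] {B : W →L[ℝ] W →L[ℝ] ℝ} (hB : IsCoercive B)
    (F : W →L[ℝ] ℝ) : ∃ z : W, ∀ v, B z v = F v := by
  refine ⟨hB.continuousLinearEquivOfBilin.symm ((InnerProductSpace.toDual ℝ W).symm F),
    fun v => ?_⟩
  rw [← hB.continuousLinearEquivOfBilin_apply, ContinuousLinearEquiv.apply_symm_apply,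
    InnerProductSpace.toDual_symm_apply]

section Elliptic

variable {d : ℕ} {D : Set (E d)}

theorem V.norm_eq_norm_grad [IsPolytopalDomain D] (v : V D) : ‖v‖ = ‖V.grad v‖ := rfl

/-- `H10 D` is complete for the graph norm, and Poincaré's inequality bounds that norm by twice the
norm of the gradient, so the gradient is bounded below. Closedness makes the range a Hilbert space
on which Lax-Milgram applies. -/
theorem V.isClosed_range_grad [IsPolytopalDomain D] :
    IsClosed (LinearMap.range (V.grad : V D →ₗ[ℝ] _) : Set (Lp (E d) 2 (volume.restrict D))) := by
  have hc : IsClosed (H10 D : Set (L2Pair D)) := (testPairs D).isClosed_topologicalClosure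
  have : CompleteSpace (H10 D) := hc.completeSpace_coe
  let G : H10 D →L[ℝ] Lp (E d) 2 (volume.restrict D) :=
    (ContinuousLinearMap.snd ℝ _ _).comp (H10 D).subtypeL
  have hG : AntilipschitzWith 2 G := by
    refine AddMonoidHomClass.antilipschitz_of_bound G fun v => ?_
    have h1 : ‖v.1.1‖ ≤ 2 * ‖v.1.2‖ := poincare v
    have h2 : ‖v‖ = max ‖v.1.1‖ ‖v.1.2‖ := rfl
    have h3 : G v = v.1.2 := rfl
    rw [h2, h3]
    refine max_le h1 ?_
    have := norm_nonneg v.1.2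
    push_cast
    linarith
  exact hG.isClosed_range G.uniformContinuous

/-- Multiplication by a bounded function, as an operator on `L²`. -/
def mulOp {μ : Measure (E d)} {a : E d → ℝ} (ha : MemLp a ∞ μ) :
    Lp (E d) 2 μ →L[ℝ] Lp (E d) 2 μ :=
  (ContinuousLinearMap.lsmul ℝ ℝ : ℝ →L[ℝ] E d →L[ℝ] E d).holderL μ ∞ 2 2 (ha.toLp a)

theorem coeFn_mulOp {μ : Measure (E d)} {a : E d → ℝ} (ha : MemLp a ∞ μ) (w : Lp (E d) 2 μ) :
    mulOp ha w =ᵐ[μ] fun x => a x • w x := by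
  have h := (ContinuousLinearMap.lsmul ℝ ℝ : ℝ →L[ℝ] E d →L[ℝ] E d).coeFn_holder
    (r := 2) (ha.toLp a) w
  filter_upwards [h, ha.coeFn_toLp] with x hx hx'
  change ContinuousLinearMap.holder 2 (ContinuousLinearMap.lsmul ℝ ℝ) (ha.toLp a) w x = a x • w x
  rw [hx, hx', ContinuousLinearMap.lsmul_apply]

theorem inner_mulOp {μ : Measure (E d)} {a : E d → ℝ} (ha : MemLp a ∞ μ) (w v : Lp (E d) 2 μ) :
    Integrable (fun x => a x * ⟪w x, v x⟫) μ ∧ ⟪mulOp ha w, v⟫ = ∫ x, a x * ⟪w x, v x⟫ ∂μ := by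
  have h : (fun x => ⟪mulOp ha w x, v x⟫) =ᵐ[μ] fun x => a x * ⟪w x, v x⟫ := by
    filter_upwards [coeFn_mulOp ha w] with x hx
    rw [hx, real_inner_smul_left]
  refine ⟨(L2.integrable_inner (𝕜 := ℝ) (mulOp ha w) v).congr h, ?_⟩
  rw [L2.inner_def]
  exact integral_congr_ae h

theorem mul_norm_sq_le_inner_mulOp {μ : Measure (E d)} {a : E d → ℝ} (ha : MemLp a ∞ μ) {m : ℝ}
    (hm : ∀ x, m ≤ a x) (w : Lp (E d) 2 μ) : m * ‖w‖ ^ 2 ≤ ⟪mulOp ha w, w⟫ := by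
  rw [(inner_mulOp ha w w).2, ← real_inner_self_eq_norm_sq, L2.inner_def, ← integral_const_mul]
  refine integral_mono ((L2.integrable_inner (𝕜 := ℝ) w w).const_mul m) (inner_mulOp ha w w).1
    fun x => ?_
  exact mul_le_mul_of_nonneg_right (hm x) real_inner_self_nonneg

theorem norm_mulOp_sub_le {μ : Measure (E d)} {a b : E d → ℝ} (ha : MemLp a ∞ μ)
    (hb : MemLp b ∞ μ) {ε : ℝ} (hε : ∀ x, |a x - b x| ≤ ε) (w : Lp (E d) 2 μ) :
    ‖mulOp ha w - mulOp hb w‖ ≤ ε * ‖w‖ := by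
  have hε0 : 0 ≤ ε := (abs_nonneg _).trans (hε 0)
  refine Lp.norm_le_mul_norm_of_ae_le_mul ?_
  filter_upwards [Lp.coeFn_sub (mulOp ha w) (mulOp hb w), coeFn_mulOp ha w, coeFn_mulOp hb w]
    with x h1 h2 h3
  rw [h1, Pi.sub_apply, h2, h3, ← sub_smul, norm_smul, Real.norm_eq_abs]
  exact mul_le_mul_of_nonneg_right (hε x) (norm_nonneg _)

/-- For bounded coefficients integrability is automatic, and the weak formulation becomes an
identity between inner products in L². -/
theorem isWeakSolution_iff [IsPolytopalDomain D] {a : E d → ℝ}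
    (ha : MemLp a ∞ (volume.restrict D)) (f : V D →L[ℝ] ℝ) (u : V D) :
    IsWeakSolution D a f u ↔ ∀ v : V D, ⟪mulOp ha (V.grad u), V.grad v⟫ = f v := by
  refine forall_congr' fun v => ?_
  rw [(inner_mulOp ha _ _).2]
  exact and_iff_right (inner_mulOp ha (V.grad u) (V.grad v)).1

theorem IsWeakSolution.norm_le [IsPolytopalDomain D] {a : E d → ℝ}
    (ha : MemLp a ∞ (volume.restrict D)) {m : ℝ} (hm0 : 0 < m) (hm : ∀ x, m ≤ a x)
    {f : V D →L[ℝ] ℝ} {u : V D} (hu : IsWeakSolution D a f u) : ‖u‖ ≤ ‖f‖ / m := by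
  have h1 := mul_norm_sq_le_inner_mulOp ha hm (V.grad u)
  rw [(isWeakSolution_iff ha f u).1 hu u, ← V.norm_eq_norm_grad] at h1
  have h2 : f u ≤ ‖f‖ * ‖u‖ := (le_abs_self _).trans (f.le_opNorm u)
  rw [le_div_iff₀ hm0]
  rcases (norm_nonneg u).eq_or_lt with h | h
  · rw [← h]; simp
  · refine le_of_mul_le_mul_right ?_ h
    nlinarith

/-- Stability of weak solutions with respect to the diffusion coefficient. -/
theorem IsWeakSolution.norm_sub_le [IsPolytopalDomain D] {a b : E d → ℝ}
    (ha : MemLp a ∞ (volume.restrict D)) (hb : MemLp b ∞ (volume.restrict D)) {m m' ε : ℝ}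
    (hm0 : 0 < m) (hm : ∀ x, m ≤ a x) (hm0' : 0 < m') (hm' : ∀ x, m' ≤ b x)
    (hε : ∀ x, |a x - b x| ≤ ε) {f : V D →L[ℝ] ℝ} {u w : V D}
    (hu : IsWeakSolution D a f u) (hw : IsWeakSolution D b f w) :
    ‖u - w‖ ≤ ε * ‖f‖ / (m * m') := by
  have hε0 : 0 ≤ ε := (abs_nonneg _).trans (hε 0)
  have h1 := mul_norm_sq_le_inner_mulOp ha hm (V.grad (u - w))
  -- Both equations have the same right-hand side, so ∫ a ∇(u-w)·∇v = ∫ (b-a) ∇w·∇v; the test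
  -- function is v = u - w.
  have h2 : ⟪mulOp ha (V.grad (u - w)), V.grad (u - w)⟫ =
      ⟪mulOp hb (V.grad w) - mulOp ha (V.grad w), V.grad (u - w)⟫ := by
    have e1 := (isWeakSolution_iff ha f u).1 hu (u - w)
    have e2 := (isWeakSolution_iff hb f w).1 hw (u - w)
    rw [inner_sub_left, e2, ← e1, ← inner_sub_left, ← map_sub, ← map_sub]
  have h3 : ‖mulOp hb (V.grad w) - mulOp ha (V.grad w)‖ ≤ ε * ‖w‖ :=
    norm_mulOp_sub_le hb ha (fun x => by rw [abs_sub_comm]; exact hε x) _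
  have h4 := hw.norm_le hb hm0' hm'
  rw [h2, ← V.norm_eq_norm_grad] at h1
  have h5 := real_inner_le_norm (mulOp hb (V.grad w) - mulOp ha (V.grad w)) (V.grad (u - w))
  rw [← V.norm_eq_norm_grad] at h5
  have h6 : m * ‖u - w‖ ≤ ε * (‖f‖ / m') := by
    rcases (norm_nonneg (u - w)).eq_or_lt with h | h
    · rw [← h]; simp only [mul_zero]; positivity
    · refine le_of_mul_le_mul_right ?_ h
      calc m * ‖u - w‖ * ‖u - w‖ = m * ‖u - w‖ ^ 2 := by ring
        _ ≤ _ := h1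
        _ ≤ _ := h5
        _ ≤ ε * (‖f‖ / m') * ‖u - w‖ := by gcongr; exact h3.trans (by gcongr)
  rw [le_div_iff₀ (by positivity)]
  calc ‖u - w‖ * (m * m') = m * ‖u - w‖ * m' := by ring
    _ ≤ ε * (‖f‖ / m') * m' := by gcongr
    _ = ε * ‖f‖ := by field_simp

/-- Existence and uniqueness of weak solutions. -/
theorem existsUnique_isWeakSolution [IsPolytopalDomain D] {a : E d → ℝ}
    (ha : MemLp a ∞ (volume.restrict D)) {m : ℝ} (hm0 : 0 < m) (hm : ∀ x, m ≤ a x)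
    (f : V D →L[ℝ] ℝ) : ∃! u : V D, IsWeakSolution D a f u := by
  refine existsUnique_of_exists_of_unique ?_ fun u w hu hw => ?_
  -- Lax-Milgram is applied on the range of the gradient, a closed subspace of L² isometric to `V
  -- D`, and the solution is carried back.
  · let W := LinearMap.range (V.grad : V D →ₗ[ℝ] Lp (E d) 2 (volume.restrict D))
    have : CompleteSpace W := V.isClosed_range_grad.completeSpace_coe
    let g : V D →ₗᵢ[ℝ] Lp (E d) 2 (volume.restrict D) := ⟨V.grad, fun v => rfl⟩
    let e : V D ≃ₗᵢ[ℝ] W := g.equivRange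
    let B : W →L[ℝ] W →L[ℝ] ℝ :=
      (innerSL ℝ).bilinearComp ((mulOp ha).comp W.subtypeL) W.subtypeL
    have hB : ∀ w v : W, B w v = ⟪mulOp ha (w : Lp (E d) 2 (volume.restrict D)), v.1⟫ :=
      fun w v => rfl
    have hco : IsCoercive B := ⟨m, hm0, fun w => by
      have h := mul_norm_sq_le_inner_mulOp ha hm (w : Lp (E d) 2 (volume.restrict D))
      rw [hB]
      refine le_trans (le_of_eq ?_) h
      rw [Submodule.coe_norm]
      ring⟩
    obtain ⟨z, hz⟩ := hco.exists_eq_apply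
      (f.comp (e.symm.toContinuousLinearEquiv : W →L[ℝ] V D))
    refine ⟨e.symm z, (isWeakSolution_iff ha f _).2 fun v => ?_⟩
    have h1 : V.grad (e.symm z) = z := congrArg Subtype.val (e.apply_symm_apply z)
    have h2 : ⟪mulOp ha (z : Lp (E d) 2 (volume.restrict D)), V.grad v⟫ = f (e.symm (e v)) :=
      hz (e v)
    rw [h1, h2, e.symm_apply_apply]
  -- Uniqueness is stability with equal coefficients, ε = 0.
  · have h := hu.norm_sub_le ha ha hm0 hm hm0 hm (ε := 0) (by simp) hw
    rw [zero_mul, zero_div] at h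
    exact sub_eq_zero.1 (norm_le_zero_iff.1 h)

end Elliptic

/-! ## Wavelet series -/

section Wavelets

variable {d : ℕ}

/-- In each coordinate at most 2R + 1 integers z satisfy |y_m - z| ≤ R, and the sum over the
resulting box factorises. Extended nonnegative values make summability conditions unnecessary. -/
theorem tsum_enorm_translate_prod_le {M R : ℝ} (hM : 0 ≤ M) (hR : 0 ≤ R) {g : Fin d → ℝ → ℝ}
    (hg : ∀ m y, |g m y| ≤ M) (hg0 : ∀ m y, R < |y| → g m y = 0) (y : Fin d → ℝ) :
    ∑' z : Fin d → ℤ, ∏ m, ‖g m (y m - z m)‖ₑ ≤ ENNReal.ofReal (((2 * R + 1) * M) ^ d) := by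
  let S : ∀ m : Fin d, Finset ℤ := fun m => Finset.Icc ⌈y m - R⌉ ⌊y m + R⌋
  rw [tsum_eq_sum (s := Fintype.piFinset S)]
  · rw [← Finset.prod_univ_sum S (fun m (z : ℤ) => ‖g m (y m - z)‖ₑ),
      ENNReal.ofReal_pow (by positivity)]
    calc _ ≤ ∏ m : Fin d, ENNReal.ofReal ((2 * R + 1) * M) := by
          refine Finset.prod_le_prod' fun m _ => ?_
          calc ∑ z ∈ S m, ‖g m (y m - z)‖ₑ ≤ ∑ z ∈ S m, ENNReal.ofReal M := by
                refine Finset.sum_le_sum fun z _ => ?_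
                rw [Real.enorm_eq_ofReal_abs]
                exact ENNReal.ofReal_le_ofReal (hg _ _)
            _ = ENNReal.ofReal ((S m).card * M) := by
                rw [Finset.sum_const, nsmul_eq_mul, ENNReal.ofReal_mul (by positivity),
                  ENNReal.ofReal_natCast]
            _ ≤ _ := by
                refine ENNReal.ofReal_le_ofReal (mul_le_mul_of_nonneg_right ?_ hM)
                rw [Int.card_Icc]
                have h1 : (⌊y m + R⌋ : ℝ) ≤ y m + R := Int.floor_le _
                have h2 : y m - R ≤ (⌈y m - R⌉ : ℝ) := Int.le_ceil _
                have h3 : (((⌊y m + R⌋ + 1 - ⌈y m - R⌉).toNat : ℤ) : ℝ) =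
                    max ((⌊y m + R⌋ : ℝ) + 1 - ⌈y m - R⌉) 0 := by
                  rw [Int.toNat_eq_max]; push_cast; rfl
                rw [Int.cast_natCast] at h3
                rw [h3]
                exact max_le (by linarith) (by linarith)
      _ = _ := by simp
  · intro z hz
    simp only [Fintype.mem_piFinset, not_forall] at hz
    obtain ⟨m, hm⟩ := hz
    refine Finset.prod_eq_zero (Finset.mem_univ m) ?_
    rw [hg0, enorm_zero]
    by_contra! h
    rw [abs_le] at h
    refine hm (Finset.mem_Icc.2 ⟨Int.ceil_le.2 ?_, Int.le_floor.2 ?_⟩) <;> linarith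

/-- Uniqueness of Euclidean division by 2^j. Positions k and periods n thus give distinct integer
translates, so the sum over both is bounded by a sum over all of ℤᵈ. -/
theorem injective_pow_mul_add (j : ℕ) : Function.Injective
    fun (q : (Fin d → Fin (2 ^ j)) × (Fin d → ℤ)) (m : Fin d) =>
      (2 : ℤ) ^ j * q.2 m + ((q.1 m : ℕ) : ℤ) := by
  rintro ⟨k, n⟩ ⟨k', n'⟩ h
  have hpos : (0 : ℤ) < 2 ^ j := by positivity
  have hlt : ∀ a : Fin (2 ^ j), ((a : ℕ) : ℤ) < 2 ^ j := fun a => by exact_mod_cast a.2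
  have key : ∀ m, k m = k' m ∧ n m = n' m := fun m => by
    have h1 : (2 : ℤ) ^ j * n m + ((k m : ℕ) : ℤ) = 2 ^ j * n' m + ((k' m : ℕ) : ℤ) :=
      congrFun h m
    have h2 := congrArg (· % (2 : ℤ) ^ j) h1
    simp only [Int.mul_add_emod_self_left] at h2
    rw [Int.emod_eq_of_lt (by positivity) (hlt _), Int.emod_eq_of_lt (by positivity) (hlt _)] at h2
    refine ⟨Fin.ext (by exact_mod_cast h2), ?_⟩
    rw [h2] at h1
    exact mul_left_cancel₀ hpos.ne' (add_right_cancel h1)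
  exact Prod.ext (funext fun m => (key m).1) (funext fun m => (key m).2)

theorem card_waveletType_le (d j : ℕ) :
    ((Finset.univ : Finset {l : Fin d → Bool // j = 0 ∨ l ≠ fun _ => false}).card : ℝ≥0∞) ≤
      ENNReal.ofReal (2 ^ d) := by
  have h : (2 : ℝ) ^ d = ((2 ^ d : ℕ) : ℝ) := by push_cast; rfl
  rw [h, ENNReal.ofReal_natCast]
  refine Nat.cast_le.2 ((Fintype.card_subtype_le _).trans ?_)
  simp

/-- At every scale the wavelets of a given type are almost disjointly supported. -/
theorem sum_enorm_wavelet_le {M R : ℝ} (hM : 0 ≤ M) (hR : 0 ≤ R) {φ ψ : ℝ → ℝ}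
    (hφ : ∀ y, |φ y| ≤ M) (hψ : ∀ y, |ψ y| ≤ M) (hφ0 : ∀ y, R < |y| → φ y = 0)
    (hψ0 : ∀ y, R < |y| → ψ y = 0) (j : ℕ) (l : {l : Fin d → Bool // j = 0 ∨ l ≠ fun _ => false})
    (x : E d) :
    ∑' k : Fin d → Fin (2 ^ j), ‖wavelet φ ψ ⟨j, k, l⟩ x‖ₑ ≤
      ENNReal.ofReal (2 ^ ((d : ℝ) * j / 2) * ((2 * R + 1) * M) ^ d) := by
  let g : Fin d → ℝ → ℝ := fun m => if l.1 m then ψ else φ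
  have hg : ∀ m y, |g m y| ≤ M := fun m y => by
    by_cases h : l.1 m <;> simp [g, h, hφ, hψ]
  have hg0 : ∀ m y, R < |y| → g m y = 0 := fun m y hy => by
    by_cases h : l.1 m <;> simp [g, h, hφ0 y hy, hψ0 y hy]
  let F : (Fin d → ℤ) → ℝ≥0∞ := fun z => ∏ m, ‖g m (2 ^ j * x m - z m)‖ₑ
  have h1 : ∀ k : Fin d → Fin (2 ^ j), ‖wavelet φ ψ ⟨j, k, l⟩ x‖ₑ ≤
      ∑' n : Fin d → ℤ, ENNReal.ofReal (2 ^ ((d : ℝ) * j / 2)) *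
        F (fun m => (2 : ℤ) ^ j * n m + ((k m : ℕ) : ℤ)) := fun k => by
    refine enorm_tsum_le_tsum_enorm.trans (ENNReal.tsum_le_tsum fun n => ?_)
    rw [enorm_mul, Real.enorm_of_nonneg (by positivity)]
    refine mul_le_mul_right (le_of_eq ?_) _
    simp only [F, enorm_eq_nnnorm, ← ENNReal.ofNNReal_finsetProd, nnnorm_prod]
    congr 2
    ext1 m
    refine congrArg (fun y => ‖g m y‖₊) ?_
    push_cast
    ring
  calc _ ≤ ∑' (k : Fin d → Fin (2 ^ j)) (n : Fin d → ℤ), ENNReal.ofReal (2 ^ ((d : ℝ) * j / 2)) *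
        F (fun m => (2 : ℤ) ^ j * n m + ((k m : ℕ) : ℤ)) := ENNReal.tsum_le_tsum h1
    _ = ENNReal.ofReal (2 ^ ((d : ℝ) * j / 2)) *
        ∑' q : (Fin d → Fin (2 ^ j)) × (Fin d → ℤ),
          F (fun m => (2 : ℤ) ^ j * q.2 m + ((q.1 m : ℕ) : ℤ)) := by
        rw [ENNReal.tsum_prod', ← ENNReal.tsum_mul_left]
        simp only [ENNReal.tsum_mul_left]
    _ ≤ ENNReal.ofReal (2 ^ ((d : ℝ) * j / 2)) * ∑' z, F z := by
        gcongr
        exact ENNReal.tsum_comp_le_tsum_of_injective (injective_pow_mul_add j) F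
    _ ≤ _ := by
        rw [ENNReal.ofReal_mul (by positivity)]
        gcongr
        exact tsum_enorm_translate_prod_le hM hR hg hg0 _

theorem measurable_wavelet {φ ψ : ℝ → ℝ} (hφ : Measurable φ) (hψ : Measurable ψ)
    (i : WaveletIndex d) : Measurable (wavelet φ ψ i) := by
  refine Measurable.tsum fun n => Measurable.const_mul ?_ _
  refine Finset.measurable_fun_prod _ fun m _ => ?_
  have h : Measurable fun x : E d => (2 : ℝ) ^ i.1 * (x m - n m) - (i.2.1 m : ℕ) := by fun_prop
  by_cases hl : i.2.2.1 m
  · simpa [hl, Function.comp_def] using hψ.comp h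
  · simpa [hl, Function.comp_def] using hφ.comp h

theorem tsum_ite_le_geometric {t : ℝ} (ht : 0 < t) (N : ℕ) :
    ∑' j : ℕ, (if N ≤ j then ENNReal.ofReal (2 ^ (-((j : ℝ) * t))) else 0) =
      ENNReal.ofReal (2 ^ (-((N : ℝ) * t)) * (1 - 2 ^ (-t))⁻¹) := by
  have hr : (2 : ℝ) ^ (-t) < 1 := Real.rpow_lt_one_of_one_lt_of_neg one_lt_two (by linarith)
  have h0 : ∀ j : ℕ, (2 : ℝ) ^ (-((j : ℝ) * t)) = (2 ^ (-t)) ^ j := fun j => by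
    rw [← Real.rpow_natCast, ← Real.rpow_mul (by norm_num)]; ring_nf
  have h1 : ∀ j : ℕ, (if N ≤ j then ENNReal.ofReal ((2 : ℝ) ^ (-((j : ℝ) * t))) else 0) =
      if N ≤ j then ENNReal.ofReal (2 ^ (-t)) ^ j else 0 := fun j => by
    rw [h0, ENNReal.ofReal_pow (by positivity)]
  have h2 : ∑ j ∈ Finset.range N, (if N ≤ j then ENNReal.ofReal ((2 : ℝ) ^ (-t)) ^ j else 0) = 0 :=
    Finset.sum_eq_zero fun j hj => if_neg (by simpa using hj)
  have h3 : ∀ j : ℕ, (if N ≤ j + N then ENNReal.ofReal ((2 : ℝ) ^ (-t)) ^ (j + N) else 0) =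
      ENNReal.ofReal (2 ^ (-t)) ^ j * ENNReal.ofReal (2 ^ (-t)) ^ N := fun j => by
    rw [if_pos (Nat.le_add_left N j), pow_add]
  rw [tsum_congr h1, ← ENNReal.summable.sum_add_tsum_nat_add' (k := N), h2, zero_add,
    tsum_congr h3, ENNReal.tsum_mul_right, ENNReal.tsum_geometric, mul_comm,
    ENNReal.ofReal_mul (by positivity), ENNReal.ofReal_inv_of_pos (by linarith),
    ENNReal.ofReal_sub _ (by positivity), ENNReal.ofReal_one, h0,
    ENNReal.ofReal_pow (by positivity)]

/-- The wavelet series with coefficients `η_j c_i`, where `η_j = 2^{-j(s + d/2 - d/p)}`. -/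
def coeffTerm (φ ψ : ℝ → ℝ) (s p : ℝ) (c : WaveletIndex d → ℝ) (x : E d) (i : WaveletIndex d) : ℝ :=
  (2 : ℝ) ^ (-((i.1 : ℝ) * (s + d / 2 - d / p))) * c i * wavelet φ ψ i x

theorem priorTerm_eq_coeffTerm (φ ψ : ℝ → ℝ) (s p : ℝ)
    (pos : ∀ j : ℕ, (Fin j → Fin (2 ^ d)) → (Fin d → Fin (2 ^ j)))
    (X : WaveletIndex d → ℝ) (t : PlaneTree) (x : E d) :
    priorTerm φ ψ s p pos X t x = coeffTerm φ ψ s p ((activeIndices pos t).indicator X) x := by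
  ext i
  by_cases h : i ∈ activeIndices pos t <;> simp [priorTerm, coeffTerm, h]

theorem measurable_coeffTerm {φ ψ : ℝ → ℝ} (hφ : Measurable φ) (hψ : Measurable ψ) (s p : ℝ)
    (c : WaveletIndex d → ℝ) (i : WaveletIndex d) :
    Measurable fun x => coeffTerm φ ψ s p c x i :=
  (measurable_wavelet hφ hψ i).const_mul _

theorem coeffTerm_sub (φ ψ : ℝ → ℝ) (s p : ℝ) (c c' : WaveletIndex d → ℝ) (x : E d) :
    coeffTerm φ ψ s p (c - c') x = coeffTerm φ ψ s p c x - coeffTerm φ ψ s p c' x := by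
  ext i
  simp only [coeffTerm, Pi.sub_apply]
  ring

/-- The constant depends neither on N nor on the coefficients, so it is deterministic when the
coefficients are random; all randomness sits in Q. -/
theorem exists_tsum_enorm_coeffTerm_le {φ ψ : ℝ → ℝ} (hφ : Continuous φ) (hψ : Continuous ψ)
    (hφc : HasCompactSupport φ) (hψc : HasCompactSupport ψ) (s p : ℝ) {t : ℝ} (ht : 0 < t) :
    ∃ C : ℝ, 0 < C ∧ ∀ (N : ℕ) (c : WaveletIndex d → ℝ) (Q : ℝ), 0 ≤ Q →
      (∀ i, |c i| ≤ 2 ^ ((i.1 : ℝ) * (s - d / p - t)) * Q) → ∀ x : E d,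
        ∑' i, (if N ≤ i.1 then ‖coeffTerm φ ψ s p c x i‖ₑ else 0) ≤
          ENNReal.ofReal (C * 2 ^ (-((N : ℝ) * t)) * Q) := by
  obtain ⟨M, hM, hφM, hψM⟩ : ∃ M : ℝ, 0 ≤ M ∧ (∀ y, |φ y| ≤ M) ∧ ∀ y, |ψ y| ≤ M := by
    obtain ⟨M₁, h₁⟩ := hφ.bounded_above_of_compact_support hφc
    obtain ⟨M₂, h₂⟩ := hψ.bounded_above_of_compact_support hψc
    exact ⟨max M₁ M₂, (norm_nonneg (φ 0)).trans ((h₁ 0).trans (le_max_left _ _)),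
      fun y => (h₁ y).trans (le_max_left _ _), fun y => (h₂ y).trans (le_max_right _ _)⟩
  obtain ⟨R, hR, hφR, hψR⟩ : ∃ R : ℝ, 0 ≤ R ∧ (∀ y, R < |y| → φ y = 0) ∧
      ∀ y, R < |y| → ψ y = 0 := by
    have key : ∀ g : ℝ → ℝ, HasCompactSupport g → ∃ R : ℝ, ∀ y, R < |y| → g y = 0 := fun g hg => by
      obtain ⟨R, h⟩ := hg.isCompact.isBounded.subset_closedBall 0
      refine ⟨R, fun y hy => image_eq_zero_of_notMem_tsupport fun hy' => ?_⟩
      have := mem_closedBall_zero_iff.1 (h hy')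
      rw [Real.norm_eq_abs] at this
      linarith
    obtain ⟨R₁, h₁⟩ := key φ hφc
    obtain ⟨R₂, h₂⟩ := key ψ hψc
    exact ⟨max 0 (max R₁ R₂), le_max_left _ _,
      fun y hy => h₁ y (by simp only [max_lt_iff] at hy; exact hy.2.1),
      fun y hy => h₂ y (by simp only [max_lt_iff] at hy; exact hy.2.2)⟩
  have hr : (2 : ℝ) ^ (-t) < 1 := Real.rpow_lt_one_of_one_lt_of_neg one_lt_two (by linarith)
  set B : ℝ := ((2 * R + 1) * M) ^ d with hB
  have hB0 : 0 ≤ B := by positivity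
  have hr' : 0 < (1 - (2 : ℝ) ^ (-t))⁻¹ := inv_pos.2 (by linarith)
  -- At most 2^d types per scale, B from the overlap of the supports, and the sum of the geometric
  -- series; B + 1 replaces B to keep the constant positive.
  refine ⟨2 ^ d * (B + 1) * (1 - 2 ^ (-t))⁻¹, by positivity, fun N c Q hQ hc x => ?_⟩
  have level : ∀ j : ℕ, ∑' q : (Fin d → Fin (2 ^ j)) ×
      {l : Fin d → Bool // j = 0 ∨ l ≠ fun _ => false},
        ‖coeffTerm φ ψ s p c x ⟨j, q⟩‖ₑ ≤
          ENNReal.ofReal (2 ^ d * (B + 1) * Q) * ENNReal.ofReal (2 ^ (-((j : ℝ) * t))) := fun j => by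
    have h1 : ∀ q : (Fin d → Fin (2 ^ j)) × {l : Fin d → Bool // j = 0 ∨ l ≠ fun _ => false},
        ‖coeffTerm φ ψ s p c x ⟨j, q⟩‖ₑ ≤
          ENNReal.ofReal (2 ^ (-((j : ℝ) * (s + d / 2 - d / p))) *
            (2 ^ ((j : ℝ) * (s - d / p - t)) * Q)) * ‖wavelet φ ψ ⟨j, q⟩ x‖ₑ := fun q => by
      rw [coeffTerm, enorm_mul]
      gcongr
      rw [Real.enorm_eq_ofReal_abs, abs_mul, abs_of_pos (by positivity)]
      gcongr
      exact hc _
    calc _ ≤ _ := ENNReal.tsum_le_tsum h1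
      _ = ENNReal.ofReal (2 ^ (-((j : ℝ) * (s + d / 2 - d / p))) *
            (2 ^ ((j : ℝ) * (s - d / p - t)) * Q)) *
          ∑' (l : {l : Fin d → Bool // j = 0 ∨ l ≠ fun _ => false}) (k : Fin d → Fin (2 ^ j)),
            ‖wavelet φ ψ ⟨j, k, l⟩ x‖ₑ := by
          rw [ENNReal.tsum_mul_left, ENNReal.tsum_prod', ENNReal.tsum_comm]
      _ ≤ ENNReal.ofReal (2 ^ (-((j : ℝ) * (s + d / 2 - d / p))) *
            (2 ^ ((j : ℝ) * (s - d / p - t)) * Q)) *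
          ∑' (l : {l : Fin d → Bool // j = 0 ∨ l ≠ fun _ => false}),
            ENNReal.ofReal (2 ^ ((d : ℝ) * j / 2) * B) := by
          refine mul_le_mul_right (ENNReal.tsum_le_tsum fun l => ?_) _
          exact sum_enorm_wavelet_le hM hR hφM hψM hφR hψR j l x
      _ ≤ ENNReal.ofReal (2 ^ (-((j : ℝ) * (s + d / 2 - d / p))) *
            (2 ^ ((j : ℝ) * (s - d / p - t)) * Q)) *
          ENNReal.ofReal (2 ^ d * (2 ^ ((d : ℝ) * j / 2) * (B + 1))) := by
          refine mul_le_mul_right ?_ _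
          rw [tsum_fintype, Finset.sum_const, nsmul_eq_mul,
            ENNReal.ofReal_mul (p := 2 ^ d) (by positivity)]
          refine mul_le_mul' ?_ (ENNReal.ofReal_le_ofReal (by gcongr; linarith))
          exact card_waveletType_le d j
      _ = _ := by
          rw [← ENNReal.ofReal_mul (by positivity), ← ENNReal.ofReal_mul (by positivity)]
          congr 1
          -- The exponents balance: -(s + d/2 - d/p) + (s - d/p - t) + d/2 = -t.
          have h2 : (2 : ℝ) ^ (-((j : ℝ) * t)) = 2 ^ (-((j : ℝ) * (s + d / 2 - d / p))) *
              2 ^ ((j : ℝ) * (s - d / p - t)) * 2 ^ ((d : ℝ) * j / 2) := by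
            rw [← Real.rpow_add (by norm_num), ← Real.rpow_add (by norm_num)]
            ring_nf
          rw [h2]
          ring
  rw [ENNReal.tsum_sigma']
  calc _ = ∑' j : ℕ, if N ≤ j then ∑' q : (Fin d → Fin (2 ^ j)) ×
          {l : Fin d → Bool // j = 0 ∨ l ≠ fun _ => false},
            ‖coeffTerm φ ψ s p c x ⟨j, q⟩‖ₑ else 0 := by
        congr 1
        ext1 j
        by_cases h : N ≤ j <;> simp [h]
    _ ≤ ∑' j : ℕ, ENNReal.ofReal (2 ^ d * (B + 1) * Q) *
          if N ≤ j then ENNReal.ofReal (2 ^ (-((j : ℝ) * t))) else 0 := by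
        refine ENNReal.tsum_le_tsum fun j => ?_
        split_ifs with h
        · exact level j
        · exact zero_le
    _ = _ := by
        rw [ENNReal.tsum_mul_left, tsum_ite_le_geometric ht, ← ENNReal.ofReal_mul (by positivity)]
        congr 1
        ring

/-- Size and tails of the wavelet series in terms of the size of its coefficients. -/
theorem exists_abs_tsum_coeffTerm_le {φ ψ : ℝ → ℝ} (hφ : Continuous φ) (hψ : Continuous ψ)
    (hφc : HasCompactSupport φ) (hψc : HasCompactSupport ψ) (s p : ℝ) {t : ℝ} (ht : 0 < t) :
    ∃ C : ℝ, 0 < C ∧ ∀ (c : WaveletIndex d → ℝ) (Q : ℝ), 0 ≤ Q →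
      (∀ i, |c i| ≤ 2 ^ ((i.1 : ℝ) * (s - d / p - t)) * Q) → ∀ x : E d,
        Summable (coeffTerm φ ψ s p c x) ∧ ∀ (N : ℕ) (S : Set (WaveletIndex d)),
          (∀ i ∈ S, N ≤ i.1) →
            |∑' i : S, coeffTerm φ ψ s p c x i| ≤ C * 2 ^ (-((N : ℝ) * t)) * Q := by
  obtain ⟨C, hC, h⟩ := exists_tsum_enorm_coeffTerm_le (d := d) hφ hψ hφc hψc s p ht
  refine ⟨C, hC, fun c Q hQ hc x => ⟨?_, fun N S hS => ?_⟩⟩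
  · have h0 := h 0 c Q hQ hc x
    simp only [zero_le, if_true] at h0
    refine Summable.of_nnnorm (ENNReal.tsum_coe_ne_top_iff_summable.1 ?_)
    exact ne_top_of_le_ne_top ENNReal.ofReal_ne_top h0
  · have h1 : ‖∑' i : S, coeffTerm φ ψ s p c x i‖ₑ ≤
        ENNReal.ofReal (C * 2 ^ (-((N : ℝ) * t)) * Q) := by
      refine enorm_tsum_le_tsum_enorm.trans (le_trans ?_ (h N c Q hQ hc x))
      rw [tsum_subtype S fun i => ‖coeffTerm φ ψ s p c x i‖ₑ]
      refine ENNReal.tsum_le_tsum fun i => ?_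
      by_cases hi : i ∈ S
      · simp [hi, hS i hi]
      · simp [hi]
    rw [Real.enorm_eq_ofReal_abs] at h1
    exact (ENNReal.ofReal_le_ofReal_iff (by positivity)).1 h1

end Wavelets

/-! ## The number of nodes of a Galton-Watson tree -/

section Trees

namespace PlaneTree

theorem finite_truncation (t : PlaneTree) (n : ℕ) : (t.truncation n).Finite := by
  induction n with
  | zero =>
    refine (finite_singleton ([] : List ℕ)).subset fun m hm => ?_
    exact List.length_eq_zero_iff.1 (Nat.le_zero.1 hm.2)
  | succ n ih =>
    choose! K hK using t.children
    refine (ih.union (ih.biUnion fun m _ => (finite_Iio (K m)).image fun i => m ++ [i])).subset ?_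
    rintro m ⟨hm, hl⟩
    rcases hl.lt_or_eq with h | h
    · exact Or.inl ⟨hm, Nat.lt_succ_iff.1 h⟩
    · right
      have hne : m ≠ [] := by rintro rfl; simp at h
      have hm' : m.dropLast ++ [m.getLast hne] = m := List.dropLast_append_getLast hne
      have hd : m.dropLast ∈ t.carrier := t.ancestor_mem _ [m.getLast hne] (by rwa [hm'])
      refine mem_iUnion₂.2 ⟨m.dropLast, ⟨hd, ?_⟩, m.getLast hne, ?_, hm'⟩
      · rw [List.length_dropLast]; omega
      · exact (hK _ hd _).1 (by rwa [hm'])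

/-- Whether n belongs to t is decided by the truncation at the length of n. Truncations are finite
sets of lists, so there are only countably many, and the event is a countable union of generating
balls. -/
theorem measurableSet_mem (n : List ℕ) : MeasurableSet {t : PlaneTree | n ∈ t.carrier} := by
  have h : {t : PlaneTree | n ∈ t.carrier} =
      ⋃ S ∈ {S : Finset (List ℕ) | n ∈ S ∧ ∃ t : PlaneTree, t.truncation n.length = S},
        {t : PlaneTree | t.truncation n.length = S} := by
    ext t
    simp only [mem_ofPred_eq, mem_iUnion, exists_prop]
    constructor
    · intro ht
      refine ⟨(t.finite_truncation n.length).toFinset, ⟨?_, t, ?_⟩, ?_⟩ <;>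
        simp [truncation, ht]
    · rintro ⟨S, ⟨hn, -⟩, hS⟩
      have : n ∈ t.truncation n.length := hS ▸ hn
      exact this.1
  rw [h]
  refine MeasurableSet.biUnion (to_countable _) ?_
  rintro S ⟨-, t, ht⟩
  refine MeasurableSpace.measurableSet_generateFrom ⟨t, n.length, ?_⟩
  rw [ht]

theorem singleton_mem_iff (t : PlaneTree) (i : ℕ) : [i] ∈ t.carrier ↔ i < t.rootDegree := by
  obtain ⟨K, hK⟩ := t.children [] t.root_mem
  have h : {i : ℕ | [i] ∈ t.carrier} = Iio K := by
    ext i; simpa using hK i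
  have h' : t.rootDegree = K := by
    rw [rootDegree, h, ← Finset.coe_Iio, Set.ncard_coe_finset, Nat.card_Iio]
  rw [h']
  simpa using hK i

/-- The condition on the root degree is needed: the sub-tree above a non-node is the one-point tree,
which still contains the root. -/
theorem cons_mem_iff (t : PlaneTree) (i : ℕ) (n : List ℕ) :
    i :: n ∈ t.carrier ↔ i < t.rootDegree ∧ n ∈ (t.subtree [i]).carrier := by
  rw [← t.singleton_mem_iff]
  constructor
  · exact fun h => ⟨t.ancestor_mem [i] n h, Or.inr h⟩
  · rintro ⟨h, rfl | h'⟩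
    · exact h
    · exact h'

theorem measurable_rootDegree : Measurable rootDegree := by
  refine measurable_of_Ioi fun i => ?_
  convert measurableSet_mem [i] using 1
  ext t
  simp [singleton_mem_iff]

end PlaneTree

variable {Ω : Type*} [MeasurableSpace Ω] {P : Measure Ω} {T : Ω → PlaneTree}

/-- Conditioning on the number k of children of the root: for i < k the sub-tree above i has the law
of T. Only this marginal law enters, not the independence of the sub-trees. -/
theorem IsGaltonWatson.measure_cons_mem [IsProbabilityMeasure P] {w : ℕ → ℝ}
    (hT : IsGaltonWatson P T w) (i : ℕ) (n : List ℕ) :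
    P {ω | i :: n ∈ (T ω).carrier} =
      ∑' k : ℕ, if i < k then ENNReal.ofReal (w k) * P {ω | n ∈ (T ω).carrier} else 0 := by
  have hdeg : ∀ k, MeasurableSet {ω | (T ω).rootDegree = k} := fun k =>
    (PlaneTree.measurable_rootDegree.comp hT.measurable) (measurableSet_singleton k)
  have hU : {ω | i :: n ∈ (T ω).carrier} =
      ⋃ k, {ω | (T ω).rootDegree = k} ∩ {ω | i :: n ∈ (T ω).carrier} := by
    rw [← iUnion_inter]
    ext ω; simp
  rw [hU, measure_iUnion]
  · refine tsum_congr fun k => ?_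
    rw [← hT.offspring]
    split_ifs with h
    · have hs : {ω | (T ω).rootDegree = k} ∩ {ω | i :: n ∈ (T ω).carrier} =
          {ω | (T ω).rootDegree = k} ∩ {ω | n ∈ ((T ω).subtree [i]).carrier} := by
        ext ω
        simp only [mem_inter_iff, mem_ofPred_eq, PlaneTree.cons_mem_iff, and_congr_right_iff,
          and_iff_right_iff_imp]
        rintro rfl _
        exact h
      rw [hs]
      by_cases h0 : P {ω | (T ω).rootDegree = k} = 0
      · rw [h0, zero_mul]
        exact measure_mono_null inter_subset_left h0
      · have hmap := (hT.branching k h0).2 ⟨i, h⟩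
        -- A map that is not a.e. measurable has push-forward 0 by convention, whereas here the
        -- push-forward equals the law of T, a probability measure.
        have hsub : AEMeasurable (fun ω => (T ω).subtree [i]) P[|{ω | (T ω).rootDegree = k}] := by
          by_contra hc
          have hz := Measure.map_of_not_aemeasurable hc
          simp only at hmap
          rw [hz] at hmap
          have := Measure.isProbabilityMeasure_map (μ := P) hT.measurable.aemeasurable
          exact IsProbabilityMeasure.ne_zero _ hmap.symm
        have h1 := congrArg (fun μ : Measure PlaneTree => μ {t | n ∈ t.carrier}) hmap
        simp only at h1
        rw [Measure.map_apply_of_aemeasurable hsub (PlaneTree.measurableSet_mem n),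
          Measure.map_apply hT.measurable (PlaneTree.measurableSet_mem n),
          cond_apply (hdeg k)] at h1
        change _ = P {ω | n ∈ (T ω).carrier} at h1
        rw [← h1, ← mul_assoc, ENNReal.mul_inv_cancel h0 (measure_ne_top _ _), one_mul]
        rfl
    · refine measure_mono_null ?_ measure_empty
      rintro ω ⟨rfl, h2⟩
      exact h ((PlaneTree.cons_mem_iff _ _ _).1 h2).1
  · intro k k' hkk'
    refine Set.disjoint_left.2 ?_
    rintro ω ⟨h1, -⟩ ⟨h2, -⟩
    exact hkk' (h1.symm.trans h2)
  · exact fun k => (hdeg k).inter (hT.measurable (PlaneTree.measurableSet_mem _))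

/-- The mean of the binomial distribution, read off from the first-moment identity for Bernstein
polynomials. -/
theorem sum_binomialWeight_mul (m : ℕ) (β : ℝ) :
    ∑ k ∈ Finset.range (m + 1), k * binomialWeight m β k = m * β := by
  have h := congrArg (Polynomial.eval β) (bernsteinPolynomial.sum_smul ℝ m)
  simp only [Polynomial.eval_finsetSum, nsmul_eq_mul, Polynomial.eval_mul,
    Polynomial.eval_natCast, Polynomial.eval_X] at h
  rw [← h]
  refine Finset.sum_congr rfl fun k _ => ?_
  simp [binomialWeight, bernsteinPolynomial]

/-- The expected number of nodes of length `j` grows at most like `(m β)^j`. -/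
theorem IsGaltonWatson.sum_measure_mem_le [IsProbabilityMeasure P] {m : ℕ} {β : ℝ} (hβ0 : 0 ≤ β)
    (hβ1 : β ≤ 1) (hT : IsGaltonWatson P T (binomialWeight m β)) (j : ℕ) :
    ∑ n : Fin j → Fin m, P {ω | List.ofFn (fun i => ((n i : Fin m) : ℕ)) ∈ (T ω).carrier} ≤
      ENNReal.ofReal ((m * β) ^ j) := by
  have hw : ∀ k, 0 ≤ binomialWeight m β k := fun k => by
    have : 0 ≤ 1 - β := by linarith
    unfold binomialWeight
    positivity
  induction j with
  | zero => simp [prob_le_one]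
  | succ j ih =>
    -- Given k children, at most k first labels a satisfy a < k; summing over a therefore produces
    -- the offspring mean m β.
    have hsum : ∀ x : ℝ≥0∞, ∑ a : Fin m, (∑' k : ℕ, if (a : ℕ) < k then
        ENNReal.ofReal (binomialWeight m β k) * x else 0) ≤ ENNReal.ofReal (m * β) * x := fun x => by
      have h0 : ∀ k : ℕ, m < k → binomialWeight m β k = 0 := fun k hk => by
        simp [binomialWeight, Nat.choose_eq_zero_of_lt hk]
      calc _ = ∑ a : Fin m, ∑ k ∈ Finset.range (m + 1), (if (a : ℕ) < k then
            ENNReal.ofReal (binomialWeight m β k) * x else 0) := by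
            refine Finset.sum_congr rfl fun a _ => tsum_eq_sum fun k hk => ?_
            rw [h0 k (by rw [Finset.mem_range] at hk; omega)]
            simp
        _ = ∑ k ∈ Finset.range (m + 1), ∑ a : Fin m, (if (a : ℕ) < k then
            ENNReal.ofReal (binomialWeight m β k) * x else 0) := Finset.sum_comm
        _ ≤ ∑ k ∈ Finset.range (m + 1), ENNReal.ofReal (k * binomialWeight m β k) * x := by
            refine Finset.sum_le_sum fun k _ => ?_
            rw [← Finset.sum_filter, Finset.sum_const, nsmul_eq_mul,
              ENNReal.ofReal_mul (by positivity), ENNReal.ofReal_natCast, mul_assoc]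
            gcongr
            calc _ = ((Finset.univ.filter fun a : Fin m => (a : ℕ) < k).map Fin.valEmbedding).card :=
                  (Finset.card_map _).symm
              _ ≤ (Finset.range k).card := Finset.card_le_card fun b hb => by
                  simp only [Finset.mem_map, Finset.mem_filter, Finset.mem_univ, true_and] at hb
                  obtain ⟨a, ha, rfl⟩ := hb
                  simpa using ha
              _ = k := Finset.card_range k
        _ = ENNReal.ofReal (m * β) * x := by
            rw [← Finset.sum_mul, ← ENNReal.ofReal_sum_of_nonneg
              fun k _ => mul_nonneg (Nat.cast_nonneg k) (hw k), sum_binomialWeight_mul]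
    rw [← (Fin.consEquiv fun _ : Fin (j + 1) => Fin m).sum_comp, Fintype.sum_prod_type]
    simp only [Fin.consEquiv_apply, List.ofFn_succ, Fin.cons_zero, Fin.cons_succ,
      hT.measure_cons_mem]
    rw [Finset.sum_comm]
    calc _ ≤ ∑ n : Fin j → Fin m, ENNReal.ofReal (m * β) *
          P {ω | List.ofFn (fun i => ((n i : Fin m) : ℕ)) ∈ (T ω).carrier} :=
          Finset.sum_le_sum fun n _ => hsum _
      _ ≤ ENNReal.ofReal (m * β) * ENNReal.ofReal ((m * β) ^ j) := by
          rw [← Finset.mul_sum]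
          gcongr
      _ = _ := by rw [← ENNReal.ofReal_mul (by positivity), pow_succ']

end Trees

/-! ## Moments of the coefficients -/

section Moments

variable {Ω : Type*} [MeasurableSpace Ω] {P : Measure Ω} {d : ℕ}

theorem exists_mul_sub_rpow_le {p κ : ℝ} (hp : 1 < p) (hκ : 0 < κ) (l : ℝ) :
    ∃ C : ℝ, ∀ x : ℝ, 0 ≤ x → l * x - x ^ p / κ ≤ C := by
  -- Beyond the threshold x = (|l| κ)^{1/(p-1)} the power x^p / κ dominates |l| x; below it the
  -- linear term is at most its value at the threshold.
  refine ⟨|l| * (|l| * κ) ^ (p - 1)⁻¹, fun x hx => ?_⟩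
  have hl := le_abs_self l
  have hp' : 0 < p - 1 := by linarith
  rcases le_total x ((|l| * κ) ^ (p - 1)⁻¹) with h | h
  · have h1 : 0 ≤ x ^ p / κ := by positivity
    have h2 : l * x ≤ |l| * x := by gcongr
    have h3 : |l| * x ≤ |l| * (|l| * κ) ^ (p - 1)⁻¹ := by gcongr
    linarith
  · have h1 : |l| * κ ≤ x ^ (p - 1) := by
      calc |l| * κ = ((|l| * κ) ^ (p - 1)⁻¹) ^ (p - 1) := by
            rw [← Real.rpow_mul (by positivity), inv_mul_cancel₀ hp'.ne', Real.rpow_one]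
        _ ≤ x ^ (p - 1) := by gcongr
    have h2 : l * x ≤ x ^ p / κ := by
      rw [le_div_iff₀ hκ]
      rcases hx.eq_or_lt with rfl | hx
      · rw [Real.zero_rpow (by linarith)]; simp
      · have h3 : x ^ p = x ^ (p - 1) * x := by
          rw [← Real.rpow_add_one hx.ne']; ring_nf
        rw [h3]
        calc l * x * κ ≤ |l| * x * κ := by gcongr
          _ = |l| * κ * x := by ring
          _ ≤ _ := by gcongr
    have h3 : 0 ≤ |l| * (|l| * κ) ^ (p - 1)⁻¹ := by positivity
    linarith

theorem integrable_exp_neg_abs : Integrable fun x : ℝ => Real.exp (-|x|) := by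
  rw [← integrableOn_univ, ← Iic_union_Ioi (a := (0 : ℝ)), integrableOn_union]
  constructor
  · refine (integrableOn_exp_Iic 0).congr_fun (fun x hx => ?_) measurableSet_Iic
    simp only [abs_of_nonpos (mem_Iic.1 hx), neg_neg]
  · refine (integrableOn_exp_neg_Ioi 0).congr_fun (fun x hx => ?_) measurableSet_Ioi
    simp only [abs_of_pos (mem_Ioi.1 hx)]

/-- All exponential moments of the `p`-exponential distribution are finite. -/
theorem IsPExponentialFamily.exists_lintegral_exp_le {ι : Type*} {p κ : ℝ} (hp : 1 < p)
    (hκ : 0 < κ) {X : ι → Ω → ℝ} (hX : IsPExponentialFamily P p κ X) (l : ℝ) :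
    ∃ K : ℝ≥0∞, K ≠ ∞ ∧ ∀ i, ∫⁻ ω, ENNReal.ofReal (Real.exp (l * |X i ω|)) ∂P ≤ K := by
  -- Using l + 1 instead of l leaves the integrable factor e^{-|x|}.
  obtain ⟨C, hC⟩ := exists_mul_sub_rpow_le hp hκ (l + 1)
  let c : ℝ := (∫ y : ℝ, Real.exp (-(|y| ^ p / κ)))⁻¹
  have hc : 0 ≤ c := inv_nonneg.2 (integral_nonneg fun y => (Real.exp_pos _).le)
  refine ⟨∫⁻ x : ℝ, ENNReal.ofReal (c * Real.exp C * Real.exp (-|x|)), ?_, fun i => ?_⟩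
  · exact (integrable_exp_neg_abs.const_mul _).lintegral_lt_top.ne
  · have hg : Measurable fun x : ℝ => ENNReal.ofReal (Real.exp (l * |x|)) := by fun_prop
    have hd : Measurable fun x : ℝ => ENNReal.ofReal (pExpDensity p κ x) := by
      unfold pExpDensity; fun_prop
    rw [← lintegral_map (f := fun x : ℝ => ENNReal.ofReal (Real.exp (l * |x|))) hg
      (hX.measurable i), hX.law i, lintegral_withDensity_eq_lintegral_mul _ hd hg]
    refine lintegral_mono fun x => ?_
    simp only [Pi.mul_apply]
    rw [← ENNReal.ofReal_mul (show 0 ≤ pExpDensity p κ x from mul_nonneg hc (Real.exp_pos _).le)]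
    refine ENNReal.ofReal_le_ofReal ?_
    change c * Real.exp (-(|x| ^ p / κ)) * Real.exp (l * |x|) ≤ _
    rw [mul_assoc, mul_assoc, ← Real.exp_add, ← Real.exp_add]
    refine mul_le_mul_of_nonneg_left (Real.exp_le_exp.2 ?_) hc
    have := hC |x| (abs_nonneg x)
    linarith

/-- Each scale carries at most 2^d types, so geometric decay of the sums over positions suffices. -/
theorem tsum_waveletIndex_ne_top {v : WaveletIndex d → ℝ≥0∞} {ε : ℝ} (hε : 0 < ε) {B : ℝ≥0∞}
    (hB : B ≠ ∞) (hv : ∀ j : ℕ, ∀ l : {l : Fin d → Bool // j = 0 ∨ l ≠ fun _ => false},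
      ∑ k : Fin d → Fin (2 ^ j), v ⟨j, k, l⟩ ≤ B * ENNReal.ofReal (2 ^ (-((j : ℝ) * ε)))) :
    ∑' i, v i ≠ ∞ := by
  have h : ∑' i, v i ≤ ENNReal.ofReal (2 ^ d) * B *
      ∑' j : ℕ, (if 0 ≤ j then ENNReal.ofReal (2 ^ (-((j : ℝ) * ε))) else 0) := by
    rw [ENNReal.tsum_sigma', ← ENNReal.tsum_mul_left]
    refine ENNReal.tsum_le_tsum fun j => ?_
    rw [if_pos (Nat.zero_le j), tsum_fintype, Fintype.sum_prod_type, Finset.sum_comm]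
    calc _ ≤ ∑ _l : {l : Fin d → Bool // j = 0 ∨ l ≠ fun _ => false},
          B * ENNReal.ofReal (2 ^ (-((j : ℝ) * ε))) := Finset.sum_le_sum fun l _ => hv j l
      _ ≤ _ := by
          rw [Finset.sum_const, nsmul_eq_mul, mul_assoc]
          exact mul_le_mul' (card_waveletType_le d j) le_rfl
  refine ne_top_of_le_ne_top ?_ h
  rw [tsum_ite_le_geometric hε]
  exact ENNReal.mul_ne_top (ENNReal.mul_ne_top ENNReal.ofReal_ne_top hB) ENNReal.ofReal_ne_top

/-- A random variable with a finite exponential moment that controls all the coefficients. -/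
theorem IsPExponentialFamily.exists_exponential_bound [IsProbabilityMeasure P] {p κ θ l : ℝ}
    (hp : 1 < p) (hκ : 0 < κ) {X : WaveletIndex d → Ω → ℝ} (hX : IsPExponentialFamily P p κ X)
    (hθ : 0 < θ) (hl : 0 < l) :
    ∃ Z : Ω → ℝ, Measurable Z ∧ (∀ ω, 0 ≤ Z ω) ∧
      (∀ᵐ ω ∂P, ∀ i, |X i ω| ≤ 2 ^ ((i.1 : ℝ) * θ) * Z ω) ∧
      ∫⁻ ω, ENNReal.ofReal (Real.exp (l * Z ω)) ∂P ≠ ∞ := by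
  -- Chosen so that (2^{jθ})^m = 2^{j(d+1)}. The weight 2^{-j(d+1)} beats the 2^{jd} positions at
  -- scale j, and is compensated by e^{m|X_i|} whenever |X_i| ≥ 2^{jθ}.
  let m : ℝ := (d + 1) / θ
  have hm : 0 < m := by positivity
  let r : WaveletIndex d → Ω → ℝ≥0∞ := fun i ω =>
    ENNReal.ofReal (2 ^ (-((i.1 : ℝ) * (d + 1)))) * ENNReal.ofReal (Real.exp ((m + l) * |X i ω|))
  have hr : ∀ i, Measurable (r i) := fun i => by
    have := hX.measurable i
    fun_prop
  let R : Ω → ℝ≥0∞ := fun ω => ∑' i, r i ω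
  have hR : Measurable R := Measurable.tsum hr
  have hRint : ∫⁻ ω, R ω ∂P ≠ ∞ := by
    obtain ⟨K, hK, hXK⟩ := hX.exists_lintegral_exp_le hp hκ (m + l)
    rw [lintegral_tsum fun i => (hr i).aemeasurable]
    refine tsum_waveletIndex_ne_top (ε := 1) one_pos hK fun j t => ?_
    have h1 : ∀ k : Fin d → Fin (2 ^ j), ∫⁻ ω, r ⟨j, k, t⟩ ω ∂P ≤
        ENNReal.ofReal (2 ^ (-((j : ℝ) * (d + 1)))) * K := fun k => by
      have := hX.measurable ⟨j, k, t⟩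
      rw [lintegral_const_mul _ (by fun_prop)]
      gcongr
      exact hXK _
    refine (Finset.sum_le_sum fun k _ => h1 k).trans (le_of_eq ?_)
    have h2 : ((2 : ℝ) ^ j) ^ d * 2 ^ (-((j : ℝ) * (d + 1))) = 2 ^ (-((j : ℝ) * 1)) := by
      rw [← pow_mul, ← Real.rpow_natCast, ← Real.rpow_add (by norm_num)]
      push_cast
      ring_nf
    rw [Finset.sum_const, nsmul_eq_mul, ← h2, ENNReal.ofReal_mul (by positivity), ← mul_assoc,
      mul_comm K]
    congr 2
    have h3 : ((2 : ℝ) ^ j) ^ d = (((2 ^ j) ^ d : ℕ) : ℝ) := by push_cast; rfl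
    rw [h3, ENNReal.ofReal_natCast]
    simp
  have hRfin : ∀ᵐ ω ∂P, R ω < ∞ := ae_lt_top hR hRint
  have hexp : ∀ ω, Real.exp (l * (Real.log (Real.exp l + (R ω).toReal) / l)) =
      Real.exp l + (R ω).toReal := fun ω => by
    have h0 : 0 < Real.exp l + (R ω).toReal := by positivity
    rw [mul_div_cancel₀ _ hl.ne', Real.exp_log h0]
  -- With Z = log(e^l + R)/l one has e^{lZ} = e^l + R, which is integrable. The term e^l covers the
  -- indices with |X_i| ≤ 2^{jθ}, the term R the others.
  refine ⟨fun ω => Real.log (Real.exp l + (R ω).toReal) / l, by fun_prop, fun ω => ?_, ?_, ?_⟩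
  · refine div_nonneg (Real.log_nonneg ?_) hl.le
    have := Real.one_le_exp hl.le
    have := ENNReal.toReal_nonneg (a := R ω)
    linarith
  · filter_upwards [hRfin] with ω hω i
    have hpos : (0 : ℝ) < 2 ^ ((i.1 : ℝ) * θ) := by positivity
    rw [← div_le_iff₀' hpos]
    refine le_of_mul_le_mul_left (Real.exp_le_exp.1 ?_) hl
    rw [hexp]
    rcases le_total |X i ω| (2 ^ ((i.1 : ℝ) * θ)) with h | h
    · have h1 : |X i ω| / 2 ^ ((i.1 : ℝ) * θ) ≤ 1 := (div_le_one hpos).2 h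
      have h2 : Real.exp (l * (|X i ω| / 2 ^ ((i.1 : ℝ) * θ))) ≤ Real.exp l :=
        Real.exp_le_exp.2 (by nlinarith)
      have := ENNReal.toReal_nonneg (a := R ω)
      linarith
    · have h1 : r i ω ≤ R ω := ENNReal.le_tsum i
      have h2 := ENNReal.toReal_mono hω.ne h1
      simp only [r] at h2
      rw [ENNReal.toReal_mul, ENNReal.toReal_ofReal (by positivity),
        ENNReal.toReal_ofReal (by positivity)] at h2
      have h3 : (2 : ℝ) ^ ((i.1 : ℝ) * (d + 1)) ≤ Real.exp (m * |X i ω|) := by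
        calc (2 : ℝ) ^ ((i.1 : ℝ) * (d + 1)) = (2 ^ ((i.1 : ℝ) * θ)) ^ m := by
              rw [← Real.rpow_mul (by norm_num)]
              congr 1
              simp only [m]
              field_simp
          _ ≤ |X i ω| ^ m := by gcongr
          _ ≤ Real.exp |X i ω| ^ m := by
              gcongr
              linarith [Real.add_one_le_exp |X i ω|]
          _ = _ := by rw [← Real.exp_mul, mul_comm]
      have h4 : |X i ω| / 2 ^ ((i.1 : ℝ) * θ) ≤ |X i ω| :=
        div_le_self (abs_nonneg _) (Real.one_le_rpow (by norm_num) (by positivity))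
      calc Real.exp (l * (|X i ω| / 2 ^ ((i.1 : ℝ) * θ))) ≤ Real.exp (l * |X i ω|) := by gcongr
        _ = 2 ^ (-((i.1 : ℝ) * (d + 1))) * (2 ^ ((i.1 : ℝ) * (d + 1)) * Real.exp (l * |X i ω|)) := by
            rw [← mul_assoc, ← Real.rpow_add (by norm_num)]; simp
        _ ≤ 2 ^ (-((i.1 : ℝ) * (d + 1))) * (Real.exp (m * |X i ω|) * Real.exp (l * |X i ω|)) := by
            gcongr
        _ = 2 ^ (-((i.1 : ℝ) * (d + 1))) * Real.exp ((m + l) * |X i ω|) := by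
            rw [← Real.exp_add, add_mul]
        _ ≤ _ := h2.trans (by linarith [Real.exp_pos l])
  · simp only [hexp]
    have h1 : ∀ ω, ENNReal.ofReal (Real.exp l + (R ω).toReal) ≤
        ENNReal.ofReal (Real.exp l) + R ω := fun ω => by
      rw [ENNReal.ofReal_add (by positivity) ENNReal.toReal_nonneg]
      gcongr
      exact ENNReal.ofReal_toReal_le
    refine ne_top_of_le_ne_top ?_ (lintegral_mono h1)
    rw [lintegral_add_left measurable_const, lintegral_const, measure_univ, mul_one]
    exact ENNReal.add_ne_top.2 ⟨ENNReal.ofReal_ne_top, hRint⟩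

theorem measurableSet_mem_activeIndices
    (pos : ∀ j : ℕ, (Fin j → Fin (2 ^ d)) → (Fin d → Fin (2 ^ j))) (i : WaveletIndex d) :
    MeasurableSet {t : PlaneTree | i ∈ activeIndices pos t} := by
  have h : {t : PlaneTree | i ∈ activeIndices pos t} = ⋃ n ∈ {n | pos i.1 n = i.2.1},
      {t : PlaneTree | List.ofFn (fun m => ((n m : Fin (2 ^ d)) : ℕ)) ∈ t.carrier} := by
    ext t
    simp [activeIndices, and_comm]
  rw [h]
  exact MeasurableSet.biUnion (to_countable _) fun n _ => PlaneTree.measurableSet_mem _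

theorem measurable_indicator_activeIndices
    (pos : ∀ j : ℕ, (Fin j → Fin (2 ^ d)) → (Fin d → Fin (2 ^ j))) {X : WaveletIndex d → Ω → ℝ}
    {T : Ω → PlaneTree} (hX : ∀ i, Measurable (X i)) (hT : Measurable T) (i : WaveletIndex d) :
    Measurable fun ω => (activeIndices pos (T ω)).indicator (fun i => X i ω) i :=
  (hX i).indicator (hT (measurableSet_mem_activeIndices pos i))

/-- The expected number of active indices of each type grows at most like `2^{γ j}`. -/
theorem IsGaltonWatson.sum_measure_active_le [IsProbabilityMeasure P] {γ : ℝ} (hγ : γ ≤ d)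
    {T : Ω → PlaneTree} (hT : IsGaltonWatson P T (binomialWeight (2 ^ d) ((2 : ℝ) ^ (γ - d))))
    (pos : ∀ j : ℕ, (Fin j → Fin (2 ^ d)) → (Fin d → Fin (2 ^ j))) (j : ℕ)
    (l : {l : Fin d → Bool // j = 0 ∨ l ≠ fun _ => false}) :
    ∑ k : Fin d → Fin (2 ^ j), P {ω | (⟨j, k, l⟩ : WaveletIndex d) ∈ activeIndices pos (T ω)} ≤
      ENNReal.ofReal (2 ^ (γ * j)) := by
  let N : (Fin j → Fin (2 ^ d)) → Set Ω := fun n =>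
    {ω | List.ofFn (fun m => ((n m : Fin (2 ^ d)) : ℕ)) ∈ (T ω).carrier}
  -- The maps `pos j` need not be injective; a union bound over each fibre suffices, and the fibres
  -- partition the nodes of length j.
  have h1 : ∀ k : Fin d → Fin (2 ^ j),
      P {ω | (⟨j, k, l⟩ : WaveletIndex d) ∈ activeIndices pos (T ω)} ≤
        ∑ n with pos j n = k, P (N n) := fun k => by
    refine (measure_mono ?_).trans (measure_biUnion_finset_le _ _)
    rintro ω ⟨n, hn, hn'⟩
    exact mem_iUnion₂.2 ⟨n, by simpa using hn', hn⟩
  calc _ ≤ ∑ k : Fin d → Fin (2 ^ j), ∑ n with pos j n = k, P (N n) :=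
        Finset.sum_le_sum fun k _ => h1 k
    _ = ∑ n, P (N n) := Finset.sum_fiberwise _ _ _
    _ ≤ _ := hT.sum_measure_mem_le (by positivity)
        (Real.rpow_le_one_of_one_le_of_nonpos one_le_two (by linarith)) j
    _ = _ := by
        congr 1
        push_cast
        rw [← Real.rpow_natCast 2 d, ← Real.rpow_add (by norm_num), add_sub_cancel,
          ← Real.rpow_natCast, ← Real.rpow_mul (by norm_num)]

/-- A random variable with a finite `r`-th moment that controls the active coefficients. -/
theorem IsPExponentialFamily.exists_moment_bound [IsProbabilityMeasure P] {p κ γ r b : ℝ}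
    (hp : 1 < p) (hκ : 0 < κ) {X : WaveletIndex d → Ω → ℝ} (hX : IsPExponentialFamily P p κ X)
    (hγ : γ ≤ d) {T : Ω → PlaneTree}
    (hT : IsGaltonWatson P T (binomialWeight (2 ^ d) ((2 : ℝ) ^ (γ - d))))
    (hXT : IndepFun (fun ω i => X i ω) T P)
    (pos : ∀ j : ℕ, (Fin j → Fin (2 ^ d)) → (Fin d → Fin (2 ^ j))) (hr : 0 < r) (hb : γ < b * r) :
    ∃ Q : Ω → ℝ, Measurable Q ∧ (∀ ω, 0 ≤ Q ω) ∧
      (∀ᵐ ω ∂P, ∀ i, |(activeIndices pos (T ω)).indicator (fun i => X i ω) i| ≤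
        2 ^ ((i.1 : ℝ) * b) * Q ω) ∧
      ∫⁻ ω, ENNReal.ofReal (Q ω ^ r) ∂P ≠ ∞ := by
  let x : WaveletIndex d → Ω → ℝ≥0∞ := fun i ω => ENNReal.ofReal (|X i ω| ^ r)
  let y : WaveletIndex d → Ω → ℝ≥0∞ := fun i ω =>
    {t : PlaneTree | i ∈ activeIndices pos t}.indicator 1 (T ω)
  have hx : ∀ i, Measurable (x i) := fun i => by
    have := hX.measurable i
    fun_prop
  have hy : ∀ i, Measurable (y i) := fun i =>
    (measurable_one.indicator (measurableSet_mem_activeIndices pos i)).comp hT.measurable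
  -- The weight is such that w_i ≤ W on an active index reads |X_i| ≤ 2^{jb} W^{1/r}. Independence
  -- of X and T factorises E w_i, so scale j contributes O(2^{j(γ - br)}). The exponent b may be
  -- negative when γ < 0.
  let w : WaveletIndex d → Ω → ℝ≥0∞ := fun i ω =>
    ENNReal.ofReal (2 ^ (-((i.1 : ℝ) * (b * r)))) * (x i ω * y i ω)
  have hw : ∀ i, Measurable (w i) := fun i => ((hx i).mul (hy i)).const_mul _
  let W : Ω → ℝ≥0∞ := fun ω => ∑' i, w i ω
  have hW : Measurable W := Measurable.tsum hw
  have hWint : ∫⁻ ω, W ω ∂P ≠ ∞ := by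
    obtain ⟨K, hK, hXK⟩ := hX.exists_lintegral_exp_le hp hκ r
    have hxK : ∀ i, ∫⁻ ω, x i ω ∂P ≤ K := fun i => by
      refine (lintegral_mono fun ω => ENNReal.ofReal_le_ofReal ?_).trans (hXK i)
      rw [mul_comm, Real.exp_mul]
      gcongr
      linarith [Real.add_one_le_exp |X i ω|]
    rw [lintegral_tsum fun i => (hw i).aemeasurable]
    refine tsum_waveletIndex_ne_top (ε := b * r - γ) (by linarith) hK fun j l => ?_
    have h1 : ∀ k : Fin d → Fin (2 ^ j), ∫⁻ ω, w ⟨j, k, l⟩ ω ∂P ≤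
        ENNReal.ofReal (2 ^ (-((j : ℝ) * (b * r)))) * K *
          P {ω | (⟨j, k, l⟩ : WaveletIndex d) ∈ activeIndices pos (T ω)} := fun k => by
      have hind : IndepFun (x ⟨j, k, l⟩) (y ⟨j, k, l⟩) P :=
        hXT.comp (φ := fun z : WaveletIndex d → ℝ => ENNReal.ofReal (|z ⟨j, k, l⟩| ^ r))
          (ψ := {t : PlaneTree | (⟨j, k, l⟩ : WaveletIndex d) ∈ activeIndices pos t}.indicator 1)
          (by fun_prop) (measurable_one.indicator (measurableSet_mem_activeIndices pos _))
      have hPy : ∫⁻ ω, y ⟨j, k, l⟩ ω ∂P =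
          P {ω | (⟨j, k, l⟩ : WaveletIndex d) ∈ activeIndices pos (T ω)} :=
        lintegral_indicator_one (hT.measurable (measurableSet_mem_activeIndices pos _))
      have hwxy : ∫⁻ ω, w ⟨j, k, l⟩ ω ∂P = ENNReal.ofReal (2 ^ (-((j : ℝ) * (b * r)))) *
          ∫⁻ ω, x ⟨j, k, l⟩ ω * y ⟨j, k, l⟩ ω ∂P :=
        lintegral_const_mul _ ((hx _).mul (hy _))
      rw [hwxy, lintegral_mul_eq_lintegral_mul_lintegral_of_indepFun'' (hx _).aemeasurable
          (hy _).aemeasurable hind, hPy, mul_assoc]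
      gcongr
      exact hxK _
    refine (Finset.sum_le_sum fun k _ => h1 k).trans ?_
    rw [← Finset.mul_sum, mul_comm _ K, mul_assoc]
    gcongr
    refine (mul_le_mul_right (hT.sum_measure_active_le hγ pos j l) _).trans (le_of_eq ?_)
    rw [← ENNReal.ofReal_mul (by positivity), ← Real.rpow_add (by norm_num)]
    ring_nf
  have hWfin : ∀ᵐ ω ∂P, W ω < ∞ := ae_lt_top hW hWint
  refine ⟨fun ω => (W ω).toReal ^ r⁻¹, by fun_prop, fun ω => by positivity, ?_, ?_⟩
  · filter_upwards [hWfin] with ω hω i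
    by_cases hi : i ∈ activeIndices pos (T ω)
    · have h1 : w i ω ≤ W ω := ENNReal.le_tsum i
      have h2 := ENNReal.toReal_mono hω.ne h1
      have h3 : y i ω = 1 := indicator_of_mem (s := {t : PlaneTree | i ∈ activeIndices pos t}) hi 1
      simp only [w, x] at h2
      rw [h3, mul_one, ENNReal.toReal_mul, ENNReal.toReal_ofReal (by positivity),
        ENNReal.toReal_ofReal (by positivity)] at h2
      rw [indicator_of_mem hi]
      calc |X i ω| = 2 ^ ((i.1 : ℝ) * b) *
            (2 ^ (-((i.1 : ℝ) * (b * r))) * |X i ω| ^ r) ^ r⁻¹ := by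
            rw [Real.mul_rpow (by positivity) (by positivity), ← Real.rpow_mul (abs_nonneg _),
              mul_inv_cancel₀ hr.ne', Real.rpow_one, ← Real.rpow_mul (by norm_num), ← mul_assoc,
              ← Real.rpow_add (by norm_num)]
            have : (i.1 : ℝ) * b + -((i.1 : ℝ) * (b * r)) * r⁻¹ = 0 := by field_simp; ring
            rw [this, Real.rpow_zero, one_mul]
        _ ≤ _ := by gcongr
    · rw [indicator_of_notMem hi, abs_zero]
      positivity
  · refine ne_top_of_le_ne_top hWint (lintegral_mono fun ω => ?_)
    rw [← Real.rpow_mul ENNReal.toReal_nonneg, inv_mul_cancel₀ hr.ne', Real.rpow_one]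
    exact ENNReal.ofReal_toReal_le

end Moments

/-! ## Log-series diffusion coefficients -/

section Assembly

variable {d : ℕ} {D : Set (E d)}

/-- The tangent inequality e^{y-x} ≥ 1 + y - x, used in both orders. -/
theorem abs_exp_sub_exp_le {x y M : ℝ} (hx : |x| ≤ M) (hy : |y| ≤ M) :
    |Real.exp x - Real.exp y| ≤ Real.exp M * |x - y| := by
  have key : ∀ x y : ℝ, |x| ≤ M → Real.exp x - Real.exp y ≤ Real.exp M * |x - y| := fun x y hx => by
    have h1 : Real.exp y = Real.exp x * Real.exp (y - x) := by rw [← Real.exp_add]; ring_nf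
    have h2 : Real.exp x * (y - x + 1) ≤ Real.exp y := by
      rw [h1]; gcongr; exact Real.add_one_le_exp _
    have h3 : Real.exp x * |x - y| ≤ Real.exp M * |x - y| := by
      gcongr; exact (le_abs_self x).trans hx
    nlinarith [Real.exp_pos x, le_abs_self (x - y)]
  rw [abs_le]
  have h1 := key x y hx
  have h2 := key y x hy
  rw [abs_sub_comm] at h2
  constructor <;> linarith

theorem memLp_top_exp {b : E d → ℝ} (hb : Measurable b) {M : ℝ} (hM : ∀ x, |b x| ≤ M) :
    MemLp (fun x => Real.exp (b x)) ∞ (volume.restrict D) :=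
  memLp_top_of_bound hb.exp.aestronglyMeasurable (Real.exp M) (ae_of_all _ fun x => by
    rw [Real.norm_eq_abs, Real.abs_exp]
    exact Real.exp_le_exp.2 ((le_abs_self _).trans (hM x)))

theorem existsUnique_isWeakSolution_exp [IsPolytopalDomain D] {b : E d → ℝ} (hb : Measurable b)
    {M : ℝ} (hM : ∀ x, |b x| ≤ M) (f : V D →L[ℝ] ℝ) :
    ∃! u : V D, IsWeakSolution D (fun x => Real.exp (b x)) f u :=
  existsUnique_isWeakSolution (memLp_top_exp hb hM) (Real.exp_pos (-M))
    (fun x => Real.exp_le_exp.2 (neg_le_of_abs_le (hM x))) f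

/-- One factor e^M is the Lipschitz constant of exp on [-M, M]; the other two are the inverse
ellipticity constants. -/
theorem IsWeakSolution.norm_sub_le_exp [IsPolytopalDomain D] {b b' : E d → ℝ}
    (hb : Measurable b) (hb' : Measurable b') {M ε : ℝ} (hM : ∀ x, |b x| ≤ M)
    (hM' : ∀ x, |b' x| ≤ M) (hε : ∀ x, |b x - b' x| ≤ ε) {f : V D →L[ℝ] ℝ} {u w : V D}
    (hu : IsWeakSolution D (fun x => Real.exp (b x)) f u)
    (hw : IsWeakSolution D (fun x => Real.exp (b' x)) f w) :
    ‖u - w‖ ≤ Real.exp (3 * M) * ε * ‖f‖ := by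
  refine (hu.norm_sub_le (memLp_top_exp hb hM) (memLp_top_exp hb' hM') (Real.exp_pos (-M))
    (fun x => Real.exp_le_exp.2 (neg_le_of_abs_le (hM x))) (Real.exp_pos (-M))
    (fun x => Real.exp_le_exp.2 (neg_le_of_abs_le (hM' x))) (ε := Real.exp M * ε)
    (fun x => (abs_exp_sub_exp_le (hM x) (hM' x)).trans (by gcongr; exact hε x)) hw).trans
    (le_of_eq ?_)
  have h : Real.exp (3 * M) = Real.exp M * (Real.exp M * Real.exp M) := by
    rw [← Real.exp_add, ← Real.exp_add]; ring_nf
  rw [h, Real.exp_neg]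
  have := Real.exp_pos M
  field_simp

/-- The part of the wavelet series with indices in `S`. -/
def partialSeries (φ ψ : ℝ → ℝ) (s p : ℝ) (S : Set (WaveletIndex d)) (c : WaveletIndex d → ℝ)
    (x : E d) : ℝ :=
  ∑' i : S, coeffTerm φ ψ s p c x i

theorem measurable_partialSeries {φ ψ : ℝ → ℝ} (hφ : Measurable φ) (hψ : Measurable ψ) (s p : ℝ)
    (S : Set (WaveletIndex d)) (c : WaveletIndex d → ℝ) :
    Measurable (partialSeries φ ψ s p S c) :=
  Measurable.tsum fun i => measurable_coeffTerm hφ hψ s p c i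

theorem prior_eq_partialSeries (φ ψ : ℝ → ℝ) (s p : ℝ)
    (pos : ∀ j : ℕ, (Fin j → Fin (2 ^ d)) → (Fin d → Fin (2 ^ j)))
    (X : WaveletIndex d → ℝ) (t : PlaneTree) :
    prior φ ψ s p pos X t = partialSeries φ ψ s p univ ((activeIndices pos t).indicator X) := by
  ext x
  rw [prior, partialSeries, priorTerm_eq_coeffTerm, tsum_univ]

theorem truncatedPrior_eq_partialSeries (φ ψ : ℝ → ℝ) (s p : ℝ)
    (pos : ∀ j : ℕ, (Fin j → Fin (2 ^ d)) → (Fin d → Fin (2 ^ j)))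
    (X : WaveletIndex d → ℝ) (t : PlaneTree) (N : ℕ) :
    truncatedPrior φ ψ s p pos X t N =
      partialSeries φ ψ s p {i | i.1 ≤ N} ((activeIndices pos t).indicator X) := by
  ext x
  rw [truncatedPrior, partialSeries, priorTerm_eq_coeffTerm]
  rfl

theorem finite_setOf_scale_le (N : ℕ) : {i : WaveletIndex d | i.1 ≤ N}.Finite := by
  refine ((finite_Iic N).biUnion fun j _ => finite_range
    fun q : (Fin d → Fin (2 ^ j)) × {l : Fin d → Bool // j = 0 ∨ l ≠ fun _ => false} =>
      (⟨j, q⟩ : WaveletIndex d)).subset ?_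
  rintro ⟨j, q⟩ hj
  exact mem_iUnion₂.2 ⟨j, hj, q, rfl⟩

theorem abs_sub_partialSeries_le {φ ψ : ℝ → ℝ} {s p : ℝ} {c : WaveletIndex d → ℝ} {x : E d}
    (hc : Summable (coeffTerm φ ψ s p c x)) {N : ℕ} {ε : ℝ}
    (h : ∀ S : Set (WaveletIndex d), (∀ i ∈ S, N ≤ i.1) → |partialSeries φ ψ s p S c x| ≤ ε) :
    |partialSeries φ ψ s p univ c x - partialSeries φ ψ s p {i | i.1 ≤ N} c x| ≤ ε := by
  have h1 := hc.tsum_subtype_add_tsum_subtype_compl {i : WaveletIndex d | i.1 ≤ N}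
  have h2 : partialSeries φ ψ s p univ c x - partialSeries φ ψ s p {i | i.1 ≤ N} c x =
      partialSeries φ ψ s p {i | i.1 ≤ N}ᶜ c x := by
    simp only [partialSeries]
    rw [tsum_univ (coeffTerm φ ψ s p c x), ← h1, add_sub_cancel_left]
  rw [h2]
  refine h _ fun i hi => ?_
  have hi' : ¬ i.1 ≤ N := hi
  -- The omitted scales start at N + 1; using only the bound N loses no more than a constant factor.
  exact (not_le.1 hi').le

/-- The solution depends measurably on finitely many random coefficients. -/
theorem aestronglyMeasurable_of_isWeakSolution_partialSeries [IsPolytopalDomain D] {Ω : Type*}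
    [MeasurableSpace Ω] {P : Measure Ω} {φ ψ : ℝ → ℝ} (hφ : Continuous φ) (hψ : Continuous ψ)
    (hφc : HasCompactSupport φ) (hψc : HasCompactSupport ψ) {s p : ℝ} (hδ : 0 < s - d / p)
    {S : Set (WaveletIndex d)} (hS : S.Finite) {c : Ω → WaveletIndex d → ℝ}
    (hc : ∀ i, Measurable fun ω => c ω i) {f : V D →L[ℝ] ℝ} {u : Ω → V D}
    (hu : ∀ᵐ ω ∂P, IsWeakSolution D (fun x => Real.exp (partialSeries φ ψ s p S (c ω) x)) f (u ω)) :
    AEStronglyMeasurable u P := by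
  have : Fintype S := hS.fintype
  obtain ⟨C, hC, hbound⟩ := exists_abs_tsum_coeffTerm_le (d := d) hφ hψ hφc hψc s p hδ
  -- Finite coefficient vectors are extended by zero. With decay parameter s - d/p the coefficient
  -- weights are all 1, so the series is bounded by the sup norm of the vector.
  let ext : (S → ℝ) → WaveletIndex d → ℝ := fun e => Function.extend Subtype.val e 0
  have hext : ∀ e i, |ext e i| ≤ 2 ^ ((i.1 : ℝ) * (s - d / p - (s - d / p))) * ‖e‖ := fun e i => by
    rw [sub_self, mul_zero, Real.rpow_zero, one_mul]
    by_cases hi : ∃ k : S, k.1 = i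
    · obtain ⟨k, rfl⟩ := hi
      simp only [ext, Subtype.val_injective.extend_apply]
      exact norm_le_pi_norm e k
    · simp only [ext, Function.extend_apply' _ _ _ hi, Pi.zero_apply, abs_zero]
      exact norm_nonneg e
  have hb : ∀ e x, |partialSeries φ ψ s p S (ext e) x| ≤ C * ‖e‖ := fun e x => by
    have h := (hbound (ext e) ‖e‖ (norm_nonneg e) (hext e) x).2 0 S fun i _ => Nat.zero_le _
    rw [Nat.cast_zero, zero_mul, neg_zero, Real.rpow_zero, mul_one] at h
    exact h
  have hsub : ∀ e e', ext (e - e') = ext e - ext e' := fun e e' => by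
    ext i
    by_cases hi : ∃ k : S, k.1 = i
    · obtain ⟨k, rfl⟩ := hi
      simp [ext]
    · simp [ext, Function.extend_apply' _ _ _ hi]
  have hdiff : ∀ e e' x, |partialSeries φ ψ s p S (ext e) x - partialSeries φ ψ s p S (ext e') x| ≤
      C * ‖e - e'‖ := fun e e' x => by
    refine le_trans (le_of_eq ?_) (hb (e - e') x)
    simp only [partialSeries, tsum_fintype, hsub, coeffTerm_sub, Pi.sub_apply,
      Finset.sum_sub_distrib]
  have hm : ∀ e, Measurable (partialSeries φ ψ s p S (ext e)) := fun e =>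
    measurable_partialSeries hφ.measurable hψ.measurable s p S _
  -- G is the deterministic solution map. Stability makes it locally Lipschitz, and by uniqueness u
  -- is almost surely G composed with the random coefficients.
  choose G hG using fun e => (existsUnique_isWeakSolution_exp (D := D) (hm e) (hb e) f).exists
  have hGc : Continuous G := by
    refine continuous_iff_continuousAt.2 fun e => ?_
    rw [ContinuousAt, tendsto_iff_norm_sub_tendsto_zero]
    have hle : ∀ e', ‖G e' - G e‖ ≤
        Real.exp (3 * (C * (‖e'‖ + ‖e‖))) * (C * ‖e' - e‖) * ‖f‖ := fun e' =>
      (hG e').norm_sub_le_exp (hm e') (hm e)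
        (fun x => (hb e' x).trans (by gcongr; linarith [norm_nonneg e]))
        (fun x => (hb e x).trans (by gcongr; linarith [norm_nonneg e'])) (hdiff e' e) (hG e)
    refine squeeze_zero (fun _ => norm_nonneg _) hle ?_
    have hcont : Continuous fun e' : S → ℝ =>
        Real.exp (3 * (C * (‖e'‖ + ‖e‖))) * (C * ‖e' - e‖) * ‖f‖ := by fun_prop
    simpa using hcont.tendsto e
  have hmeas : StronglyMeasurable fun ω => G fun i : S => c ω i :=
    hGc.stronglyMeasurable.comp_measurable (measurable_pi_lambda _ fun i => hc i)
  refine hmeas.aestronglyMeasurable.congr ?_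
  filter_upwards [hu] with ω hω
  have hserie : partialSeries φ ψ s p S (c ω) =
      partialSeries φ ψ s p S (ext fun i : S => c ω i) := by
    ext x
    refine tsum_congr fun i => ?_
    simp only [coeffTerm, ext, Subtype.val_injective.extend_apply]
  rw [hserie] at hω
  exact (existsUnique_isWeakSolution_exp (D := D) (hm _) (hb _) f).unique (hG _) hω

/-- For γ ≥ 0 the factor δ - t is positive and a large r works. For γ < 0 the hypothesis says γ <
(δ-t)q, and if δ - t is negative r must stay close to q, below γ/(δ-t). -/
theorem exists_gt_lt_mul {q t δ γ : ℝ} (hq : 1 ≤ q) (h : t < δ - min γ 0 / q) :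
    ∃ r, q < r ∧ γ < (δ - t) * r := by
  have hq0 : 0 < q := by linarith
  rcases le_or_gt 0 γ with hγ | hγ
  · rw [min_eq_right hγ, zero_div, sub_zero] at h
    refine ⟨max (q + 1) ((γ + 1) / (δ - t)), lt_max_of_lt_left (by linarith), ?_⟩
    calc γ < (δ - t) * ((γ + 1) / (δ - t)) := by
          rw [mul_div_cancel₀ _ (by linarith)]; linarith
      _ ≤ _ := mul_le_mul_of_nonneg_left (le_max_right _ _) (by linarith)
  · rw [min_eq_left hγ.le] at h
    have h1 : γ < (δ - t) * q := by
      rw [← div_lt_iff₀ hq0]; linarith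
    rcases le_or_gt 0 (δ - t) with h2 | h2
    · exact ⟨q + 1, by linarith, hγ.trans_le (by positivity)⟩
    · obtain ⟨r, hr1, hr2⟩ := exists_between ((lt_div_iff_of_neg' h2).2 h1)
      exact ⟨r, hr1, (lt_div_iff_of_neg' h2).1 hr2⟩

theorem memLp_ofReal_of_lintegral_rpow {Ω : Type*} [MeasurableSpace Ω] {P : Measure Ω} {g : Ω → ℝ}
    {r : ℝ} (hr : 0 < r) (hg : Measurable g) (hg0 : ∀ ω, 0 ≤ g ω)
    (h : ∫⁻ ω, ENNReal.ofReal (g ω ^ r) ∂P ≠ ∞) : MemLp g (ENNReal.ofReal r) P := by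
  refine ⟨hg.aestronglyMeasurable, (eLpNorm_lt_top_iff_lintegral_rpow_enorm_lt_top
    (by simpa using hr) ENNReal.ofReal_ne_top).2 ?_⟩
  rw [ENNReal.toReal_ofReal hr.le]
  refine lt_of_eq_of_lt (lintegral_congr fun ω => ?_) h.lt_top
  rw [Real.enorm_of_nonneg (hg0 ω), ENNReal.ofReal_rpow_of_nonneg (hg0 ω) hr.le]

end Assembly

end BesovTree

end

/-! ### The convergence rate of the truncated solutions -/

open BesovTree
theorem mainTheorem4
    {Ω : Type*} [MeasurableSpace Ω] (P : Measure Ω) [IsProbabilityMeasure P]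
    {d : ℕ} (D : Set (E d)) [IsPolytopalDomain D]
    (p s γ κ α : ℝ) (hp : 1 < p) (hs : 0 < s) (hsp : (d : ℝ) < s * p) (hγ : γ ≤ d) (hκ : 0 < κ)
    (hα : 1 ≤ α) (hsα : s ≤ α)
    (φ ψ : ℝ → ℝ) (hφψ : IsWaveletPair α φ ψ)
    (pos : ∀ j : ℕ, (Fin j → Fin (2 ^ d)) → (Fin d → Fin (2 ^ j)))
    (X : WaveletIndex d → Ω → ℝ) (hX : IsPExponentialFamily P p κ X)
    (T : Ω → PlaneTree)
    (hT : IsGaltonWatson P T (binomialWeight (2 ^ d) ((2 : ℝ) ^ (γ - d))))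
    (hXT : IndepFun (fun ω i => X i ω) T P)
    (f : V D →L[ℝ] ℝ)
    (a : Ω → E d → ℝ)
    (ha : ∀ ω x, a ω x = Real.exp (prior φ ψ s p pos (fun i => X i ω) (T ω) x))
    (aN : ℕ → Ω → E d → ℝ)
    (haN : ∀ N ω x,
      aN N ω x = Real.exp (truncatedPrior φ ψ s p pos (fun i => X i ω) (T ω) N x)) :
    (∀ᵐ ω ∂P, ∀ x, Summable (priorTerm φ ψ s p pos (fun i => X i ω) (T ω) x)) ∧
    (∀ᵐ ω ∂P, ∃! v : V D, IsWeakSolution D (a ω) f v) ∧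
    (∀ N : ℕ, ∀ᵐ ω ∂P, ∃! v : V D, IsWeakSolution D (aN N ω) f v) ∧
    ∀ (u : Ω → V D) (uN : ℕ → Ω → V D),
      (∀ᵐ ω ∂P, IsWeakSolution D (a ω) f (u ω)) →
      (∀ N : ℕ, ∀ᵐ ω ∂P, IsWeakSolution D (aN N ω) f (uN N ω)) →
      ∀ q : ℝ, 1 ≤ q → ∀ t : ℝ, 0 < t → t < s - d / p - min γ 0 / q →
        ∃ C : ℝ, 0 < C ∧ ∀ N : ℕ,
          MemLp (fun ω => u ω - uN N ω) (ENNReal.ofReal q) P ∧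
          eLpNorm (fun ω => u ω - uN N ω) (ENNReal.ofReal q) P ≤
            ENNReal.ofReal (C * (2 : ℝ) ^ (-(N * t))) := by

  have hp0 : 0 < p := by linarith
  have hδ : 0 < s - d / p := by
    rw [sub_pos, div_lt_iff₀ hp0]; exact hsp
  have hφ : Continuous φ := hφψ.regular_scaling.1.continuous
  have hψ : Continuous ψ := hφψ.regular_wavelet.1.continuous
  set c : Ω → WaveletIndex d → ℝ := fun ω => (activeIndices pos (T ω)).indicator fun i => X i ω
    with hc
  have hcX : ∀ ω i, |c ω i| ≤ |X i ω| := fun ω i =>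
    norm_indicator_le_norm_self (fun i => X i ω) i
  obtain rfl : a = fun ω x => Real.exp (partialSeries φ ψ s p univ (c ω) x) := by
    ext ω x; rw [ha, prior_eq_partialSeries]
  obtain rfl : aN = fun N ω x => Real.exp (partialSeries φ ψ s p {i | i.1 ≤ N} (c ω) x) := by
    ext N ω x; rw [haN, truncatedPrior_eq_partialSeries]
  simp only [priorTerm_eq_coeffTerm]
  have hm : ∀ S ω, Measurable (partialSeries φ ψ s p S (c ω)) := fun S ω =>
    measurable_partialSeries hφ.measurable hψ.measurable s p S _
  obtain ⟨C₁, hC₁, hbound⟩ := exists_abs_tsum_coeffTerm_le (d := d) hφ hψ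
    hφψ.compact_scaling hφψ.compact_wavelet s p (half_pos hδ)
  have hcoeff : ∀ Z : Ω → ℝ, (∀ᵐ ω ∂P, ∀ i, |X i ω| ≤ 2 ^ ((i.1 : ℝ) * ((s - d / p) / 2)) * Z ω) →
      ∀ᵐ ω ∂P, ∀ i, |c ω i| ≤ 2 ^ ((i.1 : ℝ) * (s - d / p - (s - d / p) / 2)) * Z ω := fun Z hZ => by
    filter_upwards [hZ] with ω hω i
    rw [sub_half]
    exact (hcX ω i).trans (hω i)
  have hsup : ∀ ω z, 0 ≤ z →
      (∀ i, |c ω i| ≤ 2 ^ ((i.1 : ℝ) * (s - d / p - (s - d / p) / 2)) * z) →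
      ∀ S x, |partialSeries φ ψ s p S (c ω) x| ≤ C₁ * z := fun ω z hz h S x => by
    have h0 := (hbound (c ω) z hz h x).2 0 S fun i _ => Nat.zero_le _
    rw [Nat.cast_zero, zero_mul, neg_zero, Real.rpow_zero, mul_one] at h0
    exact h0
  -- Only the almost sure coefficient bound is needed for well-posedness and measurability; the
  -- value l = 1 is arbitrary.
  obtain ⟨Z₁, -, hZ₁0, hZ₁, -⟩ := hX.exists_exponential_bound hp hκ (half_pos hδ) one_pos
  have hcZ₁ := hcoeff Z₁ hZ₁
  refine ⟨?_, ?_, fun N => ?_, fun u uN hu huN q hq t ht0 ht => ?_⟩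
  · filter_upwards [hcZ₁] with ω hω x
    exact (hbound (c ω) _ (hZ₁0 ω) hω x).1
  · filter_upwards [hcZ₁] with ω hω
    exact existsUnique_isWeakSolution_exp (hm _ ω) (hsup ω _ (hZ₁0 ω) hω _) f
  · filter_upwards [hcZ₁] with ω hω
    exact existsUnique_isWeakSolution_exp (hm _ ω) (hsup ω _ (hZ₁0 ω) hω _) f
  have huNm : ∀ N, AEStronglyMeasurable (uN N) P := fun N =>
    aestronglyMeasurable_of_isWeakSolution_partialSeries hφ hψ hφψ.compact_scaling
      hφψ.compact_wavelet hδ (finite_setOf_scale_le N)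
      (measurable_indicator_activeIndices pos hX.measurable hT.measurable) (huN N)
  -- No measurability of u is assumed: it is the almost sure limit of the u_N, by pathwise stability
  -- at the rate 2^{-Nδ/2}.
  have hum : AEStronglyMeasurable u P := by
    refine aestronglyMeasurable_of_tendsto_ae atTop huNm ?_
    filter_upwards [hcZ₁, hu, ae_all_iff.2 huN] with ω hω hu huN
    rw [tendsto_iff_norm_sub_tendsto_zero]
    have hle : ∀ N : ℕ, ‖uN N ω - u ω‖ ≤ Real.exp (3 * (C₁ * Z₁ ω)) *
        (C₁ * 2 ^ (-((N : ℝ) * ((s - d / p) / 2))) * Z₁ ω) * ‖f‖ := fun N => by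
      rw [norm_sub_rev]
      exact hu.norm_sub_le_exp (hm _ ω) (hm _ ω) (hsup ω _ (hZ₁0 ω) hω _)
        (hsup ω _ (hZ₁0 ω) hω _) (fun x => abs_sub_partialSeries_le
          (hbound (c ω) _ (hZ₁0 ω) hω x).1 ((hbound (c ω) _ (hZ₁0 ω) hω x).2 N)) (huN N)
    refine squeeze_zero (fun _ => norm_nonneg _) hle ?_
    have h0 : Tendsto (fun N : ℕ => (2 : ℝ) ^ (-((N : ℝ) * ((s - d / p) / 2)))) atTop (𝓝 0) := by
      have h1 : (2 : ℝ) ^ (-((s - d / p) / 2)) < 1 :=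
        Real.rpow_lt_one_of_one_lt_of_neg one_lt_two (by linarith)
      refine (tendsto_pow_atTop_nhds_zero_of_lt_one (by positivity) h1).congr fun N => ?_
      rw [← Real.rpow_natCast, ← Real.rpow_mul (by norm_num)]
      ring_nf
    simpa using (((h0.const_mul C₁).mul_const (Z₁ ω)).const_mul
      (Real.exp (3 * (C₁ * Z₁ ω)))).mul_const ‖f‖
  obtain ⟨r, hqr, hr⟩ := exists_gt_lt_mul hq ht
  have hq0 : 0 < q := by linarith
  have hr0 : 0 < r := by linarith
  obtain ⟨C₂, hC₂, hbound₂⟩ := exists_abs_tsum_coeffTerm_le (d := d) hφ hψ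
    hφψ.compact_scaling hφψ.compact_wavelet s p ht0
  obtain ⟨Q, hQm, hQ0, hQ, hQint⟩ := hX.exists_moment_bound hp hκ hγ hT hXT pos hr0 hr
  have hr'0 : 0 < q⁻¹ - r⁻¹ := sub_pos.2 (inv_strictAnti₀ hq0 hqr)
  set r' : ℝ := (q⁻¹ - r⁻¹)⁻¹ with hr'
  have hr'pos : 0 < r' := inv_pos.2 hr'0
  -- The value l = 3 C₁ r' is what puts exp(3 C₁ Z) in L^{r'}.
  obtain ⟨Z, hZm, hZ0, hZ, hZint⟩ := hX.exists_exponential_bound hp hκ (half_pos hδ)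
    (l := 3 * C₁ * r') (by positivity)
  have : ENNReal.HolderTriple (ENNReal.ofReal r') (ENNReal.ofReal r) (ENNReal.ofReal q) := ⟨by
    rw [← ENNReal.ofReal_inv_of_pos hr'pos, ← ENNReal.ofReal_inv_of_pos hr0,
      ← ENNReal.ofReal_inv_of_pos hq0, ← ENNReal.ofReal_add (by positivity) (by positivity), hr',
      inv_inv, sub_add_cancel]⟩
  have hexp : MemLp (fun ω => Real.exp (3 * (C₁ * Z ω))) (ENNReal.ofReal r') P := by
    refine memLp_ofReal_of_lintegral_rpow hr'pos (by fun_prop) (fun ω => (Real.exp_pos _).le) ?_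
    convert hZint using 5 with ω
    rw [← Real.exp_mul]
    ring_nf
  have hG := (memLp_ofReal_of_lintegral_rpow hr0 hQm hQ0 hQint).mul hexp (r := ENNReal.ofReal q)
  set G : Ω → ℝ := (fun ω => Real.exp (3 * (C₁ * Z ω))) * Q with hGdef
  set K : ℝ := (eLpNorm G (ENNReal.ofReal q) P).toReal with hK
  have hle : ∀ N : ℕ, eLpNorm (fun ω => u ω - uN N ω) (ENNReal.ofReal q) P ≤
      ENNReal.ofReal ((C₂ * ‖f‖ * K + 1) * (2 : ℝ) ^ (-(N * t))) := fun N => by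
    have hpt : ∀ᵐ ω ∂P, ‖u ω - uN N ω‖ ≤ C₂ * ‖f‖ * (2 : ℝ) ^ (-(N * t)) * ‖G ω‖ := by
      filter_upwards [hcoeff Z hZ, hQ, hu, huN N] with ω hω hωQ hu huN
      have hωQ' : ∀ i, |c ω i| ≤ 2 ^ ((i.1 : ℝ) * (s - d / p - t)) * Q ω := hωQ
      refine (hu.norm_sub_le_exp (hm _ ω) (hm _ ω) (hsup ω _ (hZ0 ω) hω _)
        (hsup ω _ (hZ0 ω) hω _) (fun x => abs_sub_partialSeries_le
          (hbound₂ (c ω) _ (hQ0 ω) hωQ' x).1 ((hbound₂ (c ω) _ (hQ0 ω) hωQ' x).2 N))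
        huN).trans (le_of_eq ?_)
      rw [hGdef, Pi.mul_apply, Real.norm_of_nonneg (mul_nonneg (Real.exp_pos _).le (hQ0 ω))]
      ring
    refine (eLpNorm_le_mul_eLpNorm_of_ae_le_mul hpt _).trans ?_
    rw [← ENNReal.ofReal_toReal hG.2.ne, ← hK, ← ENNReal.ofReal_mul (by positivity)]
    refine ENNReal.ofReal_le_ofReal ?_
    have : (0 : ℝ) < 2 ^ (-((N : ℝ) * t)) := by positivity
    nlinarith
  -- The summand 1 keeps the constant positive even if f = 0.
  refine ⟨C₂ * ‖f‖ * K + 1, by positivity, fun N => ⟨⟨hum.sub (huNm N), ?_⟩, hle N⟩⟩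
  exact (hle N).trans_lt ENNReal.ofReal_lt_top
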